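/- Fix a dimension $n\ge 1$ and $p\in(1,2]$. There is a constant $c=c(p)>0$, depending only on $p$ (and on the fixed dimension $n$), with the following property. Let $\alpha,\beta>0$, let $u_0\in L^2(\mathbb R^n;\mathbb C)$, and let $u\in C([0,\infty);L^2(\mathbb R^n))$ be the solution of the free Schrödinger equation $$\partial_t u=i\Delta u\quad (t>0,\ x\in\mathbb R^n),\qquad u(0)=u_0,$$ the equation being understood in the sense of distributions in $x$. Write $\|\cdot\|_2$ for the $L^2(\mathbb R^n)$ norm, with the value $+\infty$ for functions that are not in $L^2$, and $$\widehat f(\xi)=(2\pi)^{-n/2}\int_{\mathbb R^n}e^{-ix\cdot\xi}f(x)\,dx$$ for the Fourier transform, extended to $L^2$ by Plancherel's theorem. Then: (i) for all $T>0$ and $0\le t\le T$, with $\theta(t)=\dfrac{\beta(T-t)}{T(\alpha t+\beta)}$, $$\Big\|e^{\left|\frac{x}{\alpha t+\beta}\right|^p}u(t)\Big\|_2\le c\,\Big\|e^{\left|\frac{x}{\beta}\right|^p}u_0\Big\|_2^{\theta(t)}\,\Big\|e^{\left|\frac{x}{\alpha T+\beta}\right|^p}u(T)\Big\|_2^{1-\theta(t)};$$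 (ii) for all $t\ge 0$, with $\mu(t)=\dfrac{\beta}{\alpha t+\beta}$, $$\Big\|e^{\left|\frac{x}{\alpha t+\beta}\right|^p}u(t)\Big\|_2\le c\,\Big\|e^{\left|\frac{x}{\beta}\right|^p}u_0\Big\|_2^{\mu(t)}\,\Big\|e^{\left|\frac{2\xi}{\alpha}\right|^p}\widehat u_0\Big\|_2^{1-\mu(t)}.$$ In particular, in each inequality, if the right-hand side is finite then so is the left-hand side. (Conventions: $a^0=1$ for all $a\in[0,\infty]$, and $0\cdot\infty=0$.) -/

import Mathlib

open MeasureTheory Set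
open scoped SchwartzMap FourierTransform Laplacian ENNReal

noncomputable section

/-- The space `L²(ℝⁿ; ℂ)`, for Lebesgue measure on Euclidean space. -/
abbrev L2 (n : ℕ) : Type := Lp (α := EuclideanSpace ℝ (Fin n)) ℂ 2 volume

/-- `u ∈ C([0,∞); L²(ℝⁿ))` is the solution of the initial value problem
`∂ₜ u = i Δ u` for `t > 0`, `u(0) = u₀`, the equation being understood in the sense of
(tempered) distributions in `x`. The values of `u` at negative times play no role. -/
structure IsFreeSchrodingerSolution {n : ℕ} (u₀ : L2 n) (u : ℝ → L2 n) : Prop where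
  continuousOn : ContinuousOn u (Ici 0)
  initial : u 0 = u₀
  equation : ∀ φ : 𝓢(EuclideanSpace ℝ (Fin n), ℂ), ∀ t : ℝ, 0 < t →
    HasDerivAt (fun s : ℝ => ∫ x, u s x * φ x) (Complex.I * ∫ x, u t x * (Δ φ) x) t

/-- The Fourier transform on `L²(ℝⁿ)` in the unitary angular-frequency normalization
`f̂(ξ) = (2π)^(-n/2) ∫ exp(-i x·ξ) f(x) dx`. Mathlib's Fourier transform `𝓕`, extended to `L²` by
Plancherel's theorem, has kernel `exp(-2πi x·ξ)`, whence `f̂(ξ) = (2π)^(-n/2) (𝓕 f)(ξ / 2π)`. -/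
def angularFourier {n : ℕ} (f : L2 n) (ξ : EuclideanSpace ℝ (Fin n)) : ℂ :=
  (((2 * Real.pi) ^ (-(n : ℝ) / 2) : ℝ) : ℂ) * (𝓕 f : L2 n) ((2 * Real.pi)⁻¹ • ξ)

/-- The weighted norm `‖exp(|r x|^p) f‖₂`, with value `∞` when `exp(|r x|^p) f ∉ L²`. -/
def expPowNorm {n : ℕ} (p r : ℝ) (f : EuclideanSpace ℝ (Fin n) → ℂ) : ℝ≥0∞ :=
  eLpNorm (fun x => ((Real.exp (‖r • x‖ ^ p) : ℝ) : ℂ) * f x) 2 volume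

/-- `θ(t) = β (T - t) / (T (α t + β))`. -/
def thetaExp (α β T t : ℝ) : ℝ := β * (T - t) / (T * (α * t + β))

/-- `μ(t) = β / (α t + β)`. -/
def muExp (α β t : ℝ) : ℝ := β / (α * t + β)

end

/-
By the lens formula, `u t` is, up to a unimodular chirp and an `L²`-normalized dilation, the Fourier
transform of `exp (i k |x|²) u₀` with `k = 1 / 4t`. Absorbing a part of the chirp into `u₀`, which
does not change `|u₀|`, shifts all the parameters `k` by the same amount.

Translating `exp (i k |x|²)` by a suitable imaginary multiple of `ν / k` multiplies it by
`exp (ν · x)` and by a phase; on the Fourier side, this translation is multiplication by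
`exp ((π / k) ν · ξ)`. Hence `exp ((π / k) ν · ξ) 𝓕 (exp (i k |x|²) v)` has the same norm as
`exp ((π / k) ν · ξ) 𝓕 (exp (ν · x) v)`, which by Hölder is log-convex in `1 / k` and equal to the
norm of `exp (ν · x) v` at `1 / k = 0`. This is the theorem for linear weights. Since
`exp (|x| ^ p)` is comparable to a positive superposition of exponentials `exp (l · x)`, a second
use of Hölder gives it for these weights, and the only loss is the comparison constant.
-/

section YoungDefect

variable {σ τ a b : ℝ}

private lemma arith_sub_geom_bounds_of_le (hσ : 0 ≤ σ) (hτ : 0 < τ) (hστ : σ + τ = 1)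
    (hle : σ ≤ τ) (ha : 0 ≤ a) (hb : 0 ≤ b) :
    σ * (a - b) ^ 2 ≤ σ * a ^ 2 + τ * b ^ 2 - (a ^ 2) ^ σ * (b ^ 2) ^ τ ∧
      σ * a ^ 2 + τ * b ^ 2 - (a ^ 2) ^ σ * (b ^ 2) ^ τ ≤ τ * (a - b) ^ 2 := by
  have lower : (b ^ 2) ^ (τ - σ) * (a * b) ^ (2 * σ) ≤ (τ - σ) * b ^ 2 + 2 * σ * (a * b) :=
    Real.geom_mean_le_arith_mean2_weighted (by linarith) (by linarith) (by positivity)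
      (by positivity) (by linarith)
  have lower_eq : (b ^ 2) ^ (τ - σ) * (a * b) ^ (2 * σ) = (a ^ 2) ^ σ * (b ^ 2) ^ τ := by
    rw [Real.rpow_mul (by positivity), Real.rpow_two, mul_pow, Real.mul_rpow (by positivity)
      (by positivity), mul_left_comm, ← Real.rpow_add_of_nonneg (by positivity) (by linarith) hσ,
      sub_add_cancel]
  have upper := Real.geom_mean_le_arith_mean2_weighted (w₁ := 1 / (2 * τ))
    (w₂ := (τ - σ) / (2 * τ)) (p₁ := (a ^ 2) ^ σ * (b ^ 2) ^ τ) (p₂ := a ^ 2)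
    (by positivity) (div_nonneg (by linarith) (by positivity)) (by positivity) (by positivity)
    (by field_simp; linarith)
  have upper_eq : ((a ^ 2) ^ σ * (b ^ 2) ^ τ) ^ (1 / (2 * τ)) * (a ^ 2) ^ ((τ - σ) / (2 * τ))
      = a * b := by
    rw [Real.mul_rpow (by positivity) (by positivity), ← Real.rpow_mul (by positivity),
      ← Real.rpow_mul (by positivity), mul_right_comm,
      ← Real.rpow_add_of_nonneg (by positivity) (by positivity)
        (div_nonneg (by linarith) (by positivity)),
      show σ * (1 / (2 * τ)) + (τ - σ) / (2 * τ) = 1 / 2 by field_simp; ring,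
      show τ * (1 / (2 * τ)) = 1 / 2 by field_simp, ← Real.sqrt_eq_rpow, ← Real.sqrt_eq_rpow,
      Real.sqrt_sq ha, Real.sqrt_sq hb]
  rw [lower_eq] at lower
  rw [upper_eq, ← sub_nonneg] at upper
  refine ⟨by linarith, ?_⟩
  have := mul_nonneg (by positivity : 0 ≤ 2 * τ) upper
  field_simp at this
  linarith

lemma min_mul_sub_sq_le_arith_sub_geom (hσ : 0 < σ) (hτ : 0 < τ) (hστ : σ + τ = 1)
    (ha : 0 ≤ a) (hb : 0 ≤ b) :
    min σ τ * (a - b) ^ 2 ≤ σ * a ^ 2 + τ * b ^ 2 - (a ^ 2) ^ σ * (b ^ 2) ^ τ := by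
  rcases le_total σ τ with h | h
  · simpa only [min_eq_left h] using (arith_sub_geom_bounds_of_le hσ.le hτ hστ h ha hb).1
  · have := (arith_sub_geom_bounds_of_le hτ.le hσ (by linarith) h hb ha).1
    rw [min_eq_right h, sub_sq_comm]
    linarith

lemma arith_sub_geom_le_max_mul_sub_sq (hσ : 0 < σ) (hτ : 0 < τ) (hστ : σ + τ = 1)
    (ha : 0 ≤ a) (hb : 0 ≤ b) :
    σ * a ^ 2 + τ * b ^ 2 - (a ^ 2) ^ σ * (b ^ 2) ^ τ ≤ max σ τ * (a - b) ^ 2 := by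
  rcases le_total σ τ with h | h
  · simpa only [max_eq_right h] using (arith_sub_geom_bounds_of_le hσ.le hτ hστ h ha hb).2
  · have := (arith_sub_geom_bounds_of_le hτ.le hσ (by linarith) h hb ha).2
    rw [max_eq_left h, sub_sq_comm]
    linarith

/- Both sides are affine in `κ`, which leaves the endpoints `κ = ±1`. -/
lemma young_defect_bounds {κ : ℝ} (hσ : 0 < σ) (hτ : 0 < τ) (hστ : σ + τ = 1)
    (ha : 0 ≤ a) (hb : 0 ≤ b) (hκ : |κ| ≤ 1) :
    min σ τ / 2 * (a ^ 2 - 2 * (a * b * κ) + b ^ 2) ≤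
        σ * a ^ 2 + τ * b ^ 2 - (a ^ 2) ^ σ * (b ^ 2) ^ τ * κ ∧
      σ * a ^ 2 + τ * b ^ 2 - (a ^ 2) ^ σ * (b ^ 2) ^ τ * κ ≤
        2 * max σ τ * (a ^ 2 - 2 * (a * b * κ) + b ^ 2) := by
  have lower := min_mul_sub_sq_le_arith_sub_geom hσ hτ hστ ha hb
  have upper := arith_sub_geom_le_max_mul_sub_sq hσ hτ hστ ha hb
  obtain ⟨hκ₁, hκ₂⟩ := abs_le.mp hκ
  have hM : 0 < max σ τ := lt_max_of_lt_left hσ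
  set G := (a ^ 2) ^ σ * (b ^ 2) ^ τ
  have hG : 0 ≤ G := by positivity
  have arith_lower : min σ τ * (a ^ 2 + b ^ 2) ≤ σ * a ^ 2 + τ * b ^ 2 := by
    rw [mul_add]; gcongr; exacts [min_le_left _ _, min_le_right _ _]
  have arith_upper : σ * a ^ 2 + τ * b ^ 2 ≤ max σ τ * (a ^ 2 + b ^ 2) := by
    rw [mul_add]; gcongr; exacts [le_max_left _ _, le_max_right _ _]
  have hsq : 0 ≤ min σ τ * (a - b) ^ 2 := mul_nonneg (lt_min hσ hτ).le (sq_nonneg _)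
  have lower_pos : min σ τ / 2 * (a - b) ^ 2 ≤ σ * a ^ 2 + τ * b ^ 2 - G := by linarith
  have lower_neg : min σ τ / 2 * (a + b) ^ 2 ≤ σ * a ^ 2 + τ * b ^ 2 + G := by linarith
  have upper_pos : σ * a ^ 2 + τ * b ^ 2 - G ≤ 2 * max σ τ * (a - b) ^ 2 := by
    linarith [mul_nonneg hM.le (sq_nonneg (a - b))]
  have upper_neg : σ * a ^ 2 + τ * b ^ 2 + G ≤ 2 * max σ τ * (a + b) ^ 2 := by
    linarith [mul_nonneg hM.le (mul_nonneg ha hb)]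
  constructor
  · linarith [mul_le_mul_of_nonneg_left lower_pos (by linarith : 0 ≤ (1 + κ) / 2),
      mul_le_mul_of_nonneg_left lower_neg (by linarith : 0 ≤ (1 - κ) / 2)]
  · linarith [mul_le_mul_of_nonneg_left upper_pos (by linarith : 0 ≤ (1 + κ) / 2),
      mul_le_mul_of_nonneg_left upper_neg (by linarith : 0 ≤ (1 - κ) / 2)]

end YoungDefect

section Bregman

variable {V : Type*} [NormedAddCommGroup V] [InnerProductSpace ℝ V]

/-- The gradient of `‖·‖ ^ p` at the point `y` with `powCenter p y = w`. -/
noncomputable def powFreq (p : ℝ) (w : V) : V := (p * ‖w‖ ^ (1 - 2 / p)) • w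

/-- The radial map `y ↦ ‖y‖ ^ (p / 2 - 1) y`. -/
noncomputable def powCenter (p : ℝ) (y : V) : V := ‖y‖ ^ (p / 2 - 1) • y

variable {p κ : ℝ} {y w : V}

private lemma rpow_sub_one_mul_self {x s : ℝ} (hx : 0 ≤ x) (hs : 0 < s) :
    x ^ (s - 1) * x = x ^ s := by
  rw [← Real.rpow_add_one' hx (by linarith), sub_add_cancel]

lemma norm_powCenter_sub_sq (hp : 0 < p) (hκ : inner ℝ w y = ‖w‖ * ‖y‖ * κ) :
    ‖powCenter p y - w‖ ^ 2 =
      (‖y‖ ^ (p / 2)) ^ 2 - 2 * (‖y‖ ^ (p / 2) * ‖w‖ * κ) + ‖w‖ ^ 2 := by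
  have hnorm : ‖powCenter p y‖ = ‖y‖ ^ (p / 2) := by
    rw [powCenter, norm_smul, Real.norm_of_nonneg (by positivity),
      rpow_sub_one_mul_self (norm_nonneg y) (half_pos hp)]
  rw [norm_sub_sq_real, hnorm, powCenter, real_inner_smul_left, real_inner_comm, hκ,
    ← rpow_sub_one_mul_self (norm_nonneg y) (half_pos hp)]
  ring

lemma inner_powFreq (hp : 1 < p) (hκ : inner ℝ w y = ‖w‖ * ‖y‖ * κ) :
    inner ℝ (powFreq p w) y = p * ((‖y‖ ^ p) ^ (1 / p) * (‖w‖ ^ 2) ^ (1 - 1 / p) * κ) := by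
  have hp₀ : 0 < p := by linarith
  have exponent_pos : 0 < 2 - 2 / p := by rw [sub_pos, div_lt_iff₀ hp₀]; linarith
  rw [← Real.rpow_mul (norm_nonneg y), mul_one_div_cancel hp₀.ne', Real.rpow_one,
    ← Real.rpow_natCast_mul (norm_nonneg w), powFreq, real_inner_smul_left, hκ,
    show ((2 : ℕ) : ℝ) * (1 - 1 / p) = 2 - 2 / p by push_cast; ring,
    ← rpow_sub_one_mul_self (norm_nonneg w) exponent_pos,
    show 2 - 2 / p - 1 = 1 - 2 / p by ring]
  ring

/- The middle term is the Bregman divergence of `‖·‖ ^ p` from the point with `powCenter` equal to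
`w`. -/
lemma bregman_bounds (hp : 1 < p) (y w : V) :
    min 1 (p - 1) / 2 * ‖powCenter p y - w‖ ^ 2 ≤
        ‖y‖ ^ p + (p - 1) * ‖w‖ ^ 2 - inner ℝ (powFreq p w) y ∧
      ‖y‖ ^ p + (p - 1) * ‖w‖ ^ 2 - inner ℝ (powFreq p w) y ≤
        2 * max 1 (p - 1) * ‖powCenter p y - w‖ ^ 2 := by
  have hp₀ : 0 < p := by linarith
  obtain ⟨κ, hκ, hκ'⟩ : ∃ κ : ℝ, |κ| ≤ 1 ∧ inner ℝ w y = ‖w‖ * ‖y‖ * κ := by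
    refine ⟨_, abs_real_inner_div_norm_mul_norm_le_one w y, ?_⟩
    rcases eq_or_ne w 0 with rfl | hw
    · simp
    rcases eq_or_ne y 0 with rfl | hy
    · simp
    field_simp
  have norm_rpow : (‖y‖ ^ (p / 2)) ^ 2 = ‖y‖ ^ p := by
    rw [← Real.rpow_mul_natCast (norm_nonneg y)]
    congr 1
    push_cast
    ring
  have hp_tau : p * (1 - 1 / p) = p - 1 := by field_simp
  have hmin : p * min (1 / p) (1 - 1 / p) = min 1 (p - 1) := by
    rw [mul_min_of_nonneg _ _ hp₀.le, hp_tau, mul_one_div_cancel hp₀.ne']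
  have hmax : p * max (1 / p) (1 - 1 / p) = max 1 (p - 1) := by
    rw [mul_max_of_nonneg _ _ hp₀.le, hp_tau, mul_one_div_cancel hp₀.ne']
  have hdefect : ‖y‖ ^ p + (p - 1) * ‖w‖ ^ 2 - inner ℝ (powFreq p w) y = p * (1 / p * ‖y‖ ^ p +
      (1 - 1 / p) * ‖w‖ ^ 2 - (‖y‖ ^ p) ^ (1 / p) * (‖w‖ ^ 2) ^ (1 - 1 / p) * κ) := by
    rw [inner_powFreq hp hκ', ← hp_tau]
    field_simp
  obtain ⟨lower, upper⟩ := young_defect_bounds (σ := 1 / p) (τ := 1 - 1 / p)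
    (a := ‖y‖ ^ (p / 2)) (by positivity) (by rw [sub_pos, div_lt_one hp₀]; exact hp) (by ring)
    (by positivity) (norm_nonneg w) hκ
  rw [norm_rpow] at lower upper
  rw [norm_powCenter_sub_sq hp₀ hκ', hdefect, ← hmin, ← hmax, norm_rpow]
  exact ⟨by linarith [mul_le_mul_of_nonneg_left lower hp₀.le],
    by linarith [mul_le_mul_of_nonneg_left upper hp₀.le]⟩

end Bregman

lemma mul_rpow_one_sub_mul_mul_rpow {s : ℝ} (hs : s ∈ Icc (0 : ℝ) 1) (c x y : ℝ≥0∞) :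
    (c * x) ^ (1 - s) * (c * y) ^ s = c * (x ^ (1 - s) * y ^ s) := by
  have hs' : 0 ≤ 1 - s := sub_nonneg.mpr hs.2
  rw [ENNReal.mul_rpow_of_nonneg _ _ hs', ENNReal.mul_rpow_of_nonneg _ _ hs.1, mul_mul_mul_comm,
    ← ENNReal.rpow_add_of_nonneg _ _ hs' hs.1, sub_add_cancel, ENNReal.rpow_one]

section Superposition

variable {V : Type*} [NormedAddCommGroup V] [InnerProductSpace ℝ V] [MeasurableSpace V]

/-- The two-sided Laplace transform `∫ exp ⟪l, x⟫ dμ(x)`, with values in `[0, ∞]`. -/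
noncomputable def laplaceTransform (μ : Measure V) (l : V) : ℝ≥0∞ :=
  ∫⁻ x, ENNReal.ofReal (Real.exp (inner ℝ l x)) ∂μ

/-- The function `exp (⟪powFreq p w, x⟫ - (p - 1) ‖w‖ ^ 2)`. Superposed over `w` these exponentials
are comparable to `exp (‖x‖ ^ p)`. -/
noncomputable def powKernel (p : ℝ) (x w : V) : ℝ≥0∞ :=
  ENNReal.ofReal (Real.exp (inner ℝ (powFreq p w) x - (p - 1) * ‖w‖ ^ 2))

variable [BorelSpace V] [FiniteDimensional ℝ V]

lemma lintegral_exp_neg_mul_norm_sub_sq {a : ℝ} (ha : 0 < a) (y : V) :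
    ∫⁻ w, ENNReal.ofReal (Real.exp (-a * ‖y - w‖ ^ 2)) =
      ENNReal.ofReal ((Real.pi / a) ^ (Module.finrank ℝ V / 2 : ℝ)) := by
  have integral_eq := GaussianFourier.integral_rexp_neg_mul_sq_norm (V := V) ha
  have integrable : Integrable fun w : V => Real.exp (-a * ‖w‖ ^ 2) :=
    Integrable.of_integral_ne_zero (integral_eq ▸ by positivity)
  rw [lintegral_sub_left_eq_self (fun w : V => ENNReal.ofReal (Real.exp (-a * ‖w‖ ^ 2))) y,
    ← integral_eq, ofReal_integral_eq_lintegral_ofReal integrable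
      (.of_forall fun w => (Real.exp_pos _).le)]

variable {p : ℝ}

lemma lintegral_powKernel_le (hp : 1 < p) (x : V) :
    ∫⁻ w, powKernel p x w ≤
      ENNReal.ofReal ((Real.pi / (min 1 (p - 1) / 2)) ^ (Module.finrank ℝ V / 2 : ℝ)) *
        ENNReal.ofReal (Real.exp (‖x‖ ^ p)) := by
  have ha : 0 < min 1 (p - 1) / 2 := by have := lt_min one_pos (sub_pos.mpr hp); positivity
  rw [← lintegral_exp_neg_mul_norm_sub_sq ha (powCenter p x),
    ← lintegral_mul_const _ (by fun_prop)]
  refine lintegral_mono fun w => ?_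
  rw [powKernel, ← ENNReal.ofReal_mul (Real.exp_pos _).le, ← Real.exp_add]
  gcongr
  linarith [(bregman_bounds hp x w).1]

lemma le_lintegral_powKernel (hp : 1 < p) (x : V) :
    ENNReal.ofReal (Real.exp (‖x‖ ^ p)) *
      ENNReal.ofReal ((Real.pi / (2 * max 1 (p - 1))) ^ (Module.finrank ℝ V / 2 : ℝ)) ≤
      ∫⁻ w, powKernel p x w := by
  rw [← lintegral_exp_neg_mul_norm_sub_sq (by positivity) (powCenter p x),
    ← lintegral_const_mul _ (by fun_prop)]
  refine lintegral_mono fun w => ?_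
  rw [powKernel, ← ENNReal.ofReal_mul (Real.exp_pos _).le, ← Real.exp_add]
  gcongr
  linarith [(bregman_bounds hp x w).2]

lemma measurable_powKernel (p : ℝ) : Measurable (Function.uncurry (powKernel (V := V) p)) := by
  unfold Function.uncurry powKernel powFreq
  fun_prop

lemma lintegral_lintegral_powKernel (p : ℝ) (μ : Measure V) [SFinite μ] :
    ∫⁻ x, (∫⁻ w, powKernel p x w) ∂μ =
      ∫⁻ w, ENNReal.ofReal (Real.exp (-(p - 1) * ‖w‖ ^ 2)) *
        laplaceTransform μ (powFreq p w) := by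
  rw [lintegral_lintegral_swap (measurable_powKernel p).aemeasurable]
  refine lintegral_congr fun w => ?_
  rw [laplaceTransform, ← lintegral_const_mul _ (by fun_prop)]
  refine lintegral_congr fun x => ?_
  rw [powKernel, ← ENNReal.ofReal_mul (Real.exp_pos _).le, ← Real.exp_add]
  ring_nf

lemma measurable_laplaceTransform (μ : Measure V) [SFinite μ] :
    Measurable (laplaceTransform μ) :=
  Measurable.lintegral_prod_right'
    (f := fun z : V × V => ENNReal.ofReal (Real.exp (inner ℝ z.1 z.2))) (by fun_prop)

lemma lintegral_powKernel_interpolate (p : ℝ) {μ μ₀ μ₁ : Measure V} [SFinite μ] [SFinite μ₀]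
    [SFinite μ₁] {s : ℝ} (hs : s ∈ Icc (0 : ℝ) 1)
    (h : ∀ l, laplaceTransform μ l ≤
      laplaceTransform μ₀ l ^ (1 - s) * laplaceTransform μ₁ l ^ s) :
    ∫⁻ x, (∫⁻ w, powKernel p x w) ∂μ ≤
      (∫⁻ x, (∫⁻ w, powKernel p x w) ∂μ₀) ^ (1 - s) *
        (∫⁻ x, (∫⁻ w, powKernel p x w) ∂μ₁) ^ s := by
  have hs' : 0 ≤ 1 - s := sub_nonneg.mpr hs.2
  have measurable_powFreq : Measurable (powFreq (V := V) p) := by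
    unfold powFreq
    fun_prop
  have measurable_slice (ν : Measure V) [SFinite ν] :
      Measurable fun w : V => ENNReal.ofReal (Real.exp (-(p - 1) * ‖w‖ ^ 2)) *
        laplaceTransform ν (powFreq p w) :=
    Measurable.mul (by fun_prop) ((measurable_laplaceTransform ν).comp measurable_powFreq)
  simp only [lintegral_lintegral_powKernel]
  refine le_trans (lintegral_mono fun w => ?_) (ENNReal.lintegral_mul_norm_pow_le
    (measurable_slice μ₀).aemeasurable (measurable_slice μ₁).aemeasurable hs' hs.1 (by ring))
  calc _ ≤ ENNReal.ofReal (Real.exp (-(p - 1) * ‖w‖ ^ 2)) *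
        (laplaceTransform μ₀ (powFreq p w) ^ (1 - s) *
          laplaceTransform μ₁ (powFreq p w) ^ s) := by gcongr; exact h _
    _ = _ := by rw [mul_rpow_one_sub_mul_mul_rpow hs]

/-- The ratio of the two Gaussian integrals that compare `∫ powKernel p x w dw` with
`exp (‖x‖ ^ p)` in dimension `d`. -/
noncomputable def powConst (d : ℕ) (p : ℝ) : ℝ :=
  (4 * max 1 (p - 1) / min 1 (p - 1)) ^ (d / 2 : ℝ)

lemma one_le_powConst (d : ℕ) (hp : 1 < p) : 1 ≤ powConst d p := by
  have hmin : 0 < min 1 (p - 1) := lt_min one_pos (sub_pos.mpr hp)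
  refine Real.one_le_rpow ((one_le_div hmin).mpr ?_) (by positivity)
  linarith [min_le_left 1 (p - 1), le_max_left 1 (p - 1)]

/- Log-convexity of `‖e^{l·x}‖` in each direction passes to `exp (‖x‖ ^ p)` because the latter is
comparable to a positive superposition of exponentials, and Hölder applies to the superposition. -/
theorem lintegral_exp_norm_rpow_interpolate (hp : 1 < p) {μ μ₀ μ₁ : Measure V}
    [SFinite μ] [SFinite μ₀] [SFinite μ₁] {s : ℝ} (hs : s ∈ Icc (0 : ℝ) 1)
    (h : ∀ l, laplaceTransform μ l ≤
      laplaceTransform μ₀ l ^ (1 - s) * laplaceTransform μ₁ l ^ s) :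
    ∫⁻ x, ENNReal.ofReal (Real.exp (‖x‖ ^ p)) ∂μ ≤
      ENNReal.ofReal (powConst (Module.finrank ℝ V) p) *
        (∫⁻ x, ENNReal.ofReal (Real.exp (‖x‖ ^ p)) ∂μ₀) ^ (1 - s) *
        (∫⁻ x, ENNReal.ofReal (Real.exp (‖x‖ ^ p)) ∂μ₁) ^ s := by
  have hs' : 0 ≤ 1 - s := sub_nonneg.mpr hs.2
  set J : Measure V → ℝ≥0∞ := fun ν => ∫⁻ x, ENNReal.ofReal (Real.exp (‖x‖ ^ p)) ∂ν with hJ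
  set A : ℝ := (Real.pi / (min 1 (p - 1) / 2)) ^ (Module.finrank ℝ V / 2 : ℝ) with hA
  set B : ℝ := (Real.pi / (2 * max 1 (p - 1))) ^ (Module.finrank ℝ V / 2 : ℝ) with hB
  have hBpos : 0 < B := by positivity
  have hAB : A = powConst (Module.finrank ℝ V) p * B := by
    rw [hA, hB, powConst, ← Real.mul_rpow (by positivity) (by positivity)]
    congr 1
    field_simp
    ring
  have upper (ν : Measure V) :
      ∫⁻ x, (∫⁻ w, powKernel p x w) ∂ν ≤ ENNReal.ofReal A * J ν := by
    rw [hJ, ← lintegral_const_mul _ (by fun_prop)]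
    exact lintegral_mono (lintegral_powKernel_le hp)
  have lower : J μ * ENNReal.ofReal B ≤ ∫⁻ x, (∫⁻ w, powKernel p x w) ∂μ := by
    rw [hJ, ← lintegral_mul_const _ (by fun_prop)]
    exact lintegral_mono (le_lintegral_powKernel hp)
  refine (ENNReal.mul_le_mul_iff_left (ENNReal.ofReal_pos.mpr hBpos).ne'
    ENNReal.ofReal_ne_top).mp ?_
  calc J μ * ENNReal.ofReal B
      ≤ (∫⁻ x, (∫⁻ w, powKernel p x w) ∂μ₀) ^ (1 - s) *
          (∫⁻ x, (∫⁻ w, powKernel p x w) ∂μ₁) ^ s :=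
        lower.trans (lintegral_powKernel_interpolate p hs h)
    _ ≤ (ENNReal.ofReal A * J μ₀) ^ (1 - s) * (ENNReal.ofReal A * J μ₁) ^ s :=
        mul_le_mul' (ENNReal.rpow_le_rpow (upper μ₀) hs') (ENNReal.rpow_le_rpow (upper μ₁) hs.1)
    _ = ENNReal.ofReal A * (J μ₀ ^ (1 - s) * J μ₁ ^ s) := by
        rw [mul_rpow_one_sub_mul_mul_rpow hs]
    _ = _ := by
        rw [hAB, ENNReal.ofReal_mul (zero_le_one.trans (one_le_powConst _ hp))]
        ring

end Superposition

section SchwartzExponential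

variable {V : Type*} [NormedAddCommGroup V] [NormedSpace ℝ V]

lemma norm_iteratedFDeriv_cexp_le (i : ℕ) (z : ℂ) :
    ‖iteratedFDeriv ℝ i Complex.exp z‖ ≤ ‖Complex.exp z‖ := by
  rw [← (Complex.contDiff_exp (𝕜 := ℂ) (n := i)).contDiffAt.restrictScalars_iteratedFDeriv (𝕜 := ℝ)]
  simp only [Function.comp_apply, ContinuousMultilinearMap.norm_restrictScalars]
  rw [norm_iteratedFDeriv_eq_norm_iteratedDeriv, iteratedDeriv_eq_iterate, Complex.iter_deriv_exp]

lemma norm_iteratedFDeriv_cexp_comp_le {q : V → ℂ} (hq : Function.HasTemperateGrowth q) (N : ℕ) :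
    ∃ (k : ℕ) (K : ℝ), 0 ≤ K ∧ ∀ x, ‖iteratedFDeriv ℝ N (fun x => Complex.exp (q x)) x‖ ≤
      K * ((1 + ‖x‖) ^ k * ‖Complex.exp (q x)‖) := by
  obtain ⟨k, C, hC, hbound⟩ := hq.norm_iteratedFDeriv_le_uniform N
  refine ⟨k * N, N.factorial * (1 + C) ^ N, by positivity, fun x => ?_⟩
  have one_le : 1 ≤ (1 + C) * (1 + ‖x‖) ^ k :=
    one_le_mul_of_one_le_of_one_le (by linarith) (one_le_pow₀ (by linarith [norm_nonneg x]))
  have deriv_le (i : ℕ) (hi : 1 ≤ i) (hiN : i ≤ N) :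
      ‖iteratedFDeriv ℝ i q x‖ ≤ ((1 + C) * (1 + ‖x‖) ^ k) ^ i :=
    calc _ ≤ C * (1 + ‖x‖) ^ k := hbound i hiN x
      _ ≤ (1 + C) * (1 + ‖x‖) ^ k := by gcongr; linarith
      _ ≤ _ := le_self_pow₀ one_le (by omega)
  refine (norm_iteratedFDeriv_comp_le (𝕜 := ℝ) (n := N) (N := (⊤ : ℕ∞))
    (Complex.contDiff_exp (𝕜 := ℝ)) hq.1 (by exact_mod_cast le_top) x
    (fun i _ => norm_iteratedFDeriv_cexp_le i _) deriv_le).trans_eq ?_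
  rw [mul_pow, ← pow_mul]
  ring

/-- The exponential of a function of temperate growth as a Schwartz function, when it decays
rapidly: the derivatives then decay rapidly too. -/
noncomputable def cexpSchwartz (q : V → ℂ) (hq : Function.HasTemperateGrowth q)
    (hdecay : ∀ k : ℕ, ∃ C : ℝ, ∀ x, (1 + ‖x‖) ^ k * ‖Complex.exp (q x)‖ ≤ C) : 𝓢(V, ℂ) where
  toFun x := Complex.exp (q x)
  smooth' := (Complex.contDiff_exp (𝕜 := ℝ)).comp hq.1
  decay' k N := by
    obtain ⟨m, K, hK, hderiv⟩ := norm_iteratedFDeriv_cexp_comp_le hq N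
    obtain ⟨C, hC⟩ := hdecay (k + m)
    refine ⟨K * C, fun x => ?_⟩
    calc _ ≤ (1 + ‖x‖) ^ k * (K * ((1 + ‖x‖) ^ m * ‖Complex.exp (q x)‖)) := by
          gcongr
          exacts [le_add_of_nonneg_left zero_le_one, hderiv x]
      _ = K * ((1 + ‖x‖) ^ (k + m) * ‖Complex.exp (q x)‖) := by ring
      _ ≤ K * C := by gcongr; exact hC x

end SchwartzExponential

section Gaussian

variable {n : ℕ}

/-- The complex Gaussian `exp (-c |x|² + b · x)`. -/
noncomputable def gaussFn (c : ℂ) (b : Fin n → ℂ) (x : EuclideanSpace ℝ (Fin n)) : ℂ :=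
  Complex.exp (-c * ‖x‖ ^ 2 + ∑ i, b i * x i)

lemma hasTemperateGrowth_gaussExponent (c : ℂ) (b : Fin n → ℂ) :
    Function.HasTemperateGrowth
      (fun x : EuclideanSpace ℝ (Fin n) => -c * (‖x‖ : ℂ) ^ 2 + ∑ i, b i * (x i : ℂ)) := by
  have normSq : Function.HasTemperateGrowth
      (fun x : EuclideanSpace ℝ (Fin n) => (‖x‖ : ℂ) ^ 2) := by
    simpa only [Function.comp_def, Complex.ofReal_pow] using
      Function.Complex.hasTemperateGrowth_ofReal.comp
        (Function.hasTemperateGrowth_norm_sq (H := EuclideanSpace ℝ (Fin n)))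
  have coord (i : Fin n) : Function.HasTemperateGrowth
      (fun x : EuclideanSpace ℝ (Fin n) => (x i : ℂ)) :=
    Function.Complex.hasTemperateGrowth_ofReal.comp
      (EuclideanSpace.proj (𝕜 := ℝ) i).hasTemperateGrowth
  exact ((Function.HasTemperateGrowth.const _).mul normSq).add
    (.sum fun i _ => (Function.HasTemperateGrowth.const _).mul (coord i))

lemma norm_gaussFn_le (c : ℂ) (b : Fin n → ℂ) (x : EuclideanSpace ℝ (Fin n)) :
    ‖gaussFn c b x‖ ≤ Real.exp (-c.re * ‖x‖ ^ 2 + (∑ i, ‖b i‖) * ‖x‖) := by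
  rw [gaussFn, Complex.norm_exp, Complex.add_re, Complex.re_sum, Finset.sum_mul]
  gcongr with i
  · rw [← Complex.ofReal_pow, Complex.re_mul_ofReal, Complex.neg_re]
  · calc (b i * x i).re ≤ ‖b i * x i‖ := Complex.re_le_norm _
      _ = ‖b i‖ * ‖x i‖ := by rw [norm_mul, Complex.norm_real]
      _ ≤ ‖b i‖ * ‖x‖ := by gcongr; exact PiLp.norm_apply_le x i

lemma gaussFn_decay {c : ℂ} (hc : 0 < c.re) (b : Fin n → ℂ) (k : ℕ) :
    ∃ C : ℝ, ∀ x : EuclideanSpace ℝ (Fin n), (1 + ‖x‖) ^ k * ‖gaussFn c b x‖ ≤ C := by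
  set M := ∑ i, ‖b i‖
  refine ⟨k.factorial * Real.exp (1 + (M + 1) ^ 2 / (4 * c.re)), fun x => ?_⟩
  have pow_le : (1 + ‖x‖) ^ k ≤ k.factorial * Real.exp (1 + ‖x‖) := by
    have := Real.pow_div_factorial_le_exp (1 + ‖x‖) (by positivity) k
    rwa [div_le_iff₀' (by positivity)] at this
  have complete_square : -c.re * ‖x‖ ^ 2 + (M + 1) * ‖x‖ ≤ (M + 1) ^ 2 / (4 * c.re) := by
    rw [le_div_iff₀ (by positivity)]
    linarith [sq_nonneg (2 * c.re * ‖x‖ - (M + 1))]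
  calc _ ≤ (k.factorial * Real.exp (1 + ‖x‖)) * Real.exp (-c.re * ‖x‖ ^ 2 + M * ‖x‖) := by
        gcongr
        exact norm_gaussFn_le c b x
    _ = k.factorial * Real.exp (1 + (-c.re * ‖x‖ ^ 2 + (M + 1) * ‖x‖)) := by
        rw [mul_assoc, ← Real.exp_add]
        ring_nf
    _ ≤ _ := by gcongr

/-- The complex Gaussian `exp (-c |x|² + b · x)` as a Schwartz function. -/
noncomputable def gaussSchwartz {c : ℂ} (hc : 0 < c.re) (b : Fin n → ℂ) :
    𝓢(EuclideanSpace ℝ (Fin n), ℂ) :=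
  cexpSchwartz _ (hasTemperateGrowth_gaussExponent c b) (gaussFn_decay hc b)

@[simp] lemma coe_gaussSchwartz {c : ℂ} (hc : 0 < c.re) (b : Fin n → ℂ) :
    ⇑(gaussSchwartz hc b) = gaussFn c b := rfl

/-- The factor `(π / c) ^ (n / 2) exp (b · b / 4c)` in the Fourier transform of `gaussFn c b`. -/
noncomputable def gaussConst (c : ℂ) (b : Fin n → ℂ) : ℂ :=
  (Real.pi / c) ^ ((n : ℂ) / 2) * Complex.exp ((∑ i, b i ^ 2) / (4 * c))

lemma integral_gaussFn {c : ℂ} (hc : 0 < c.re) (b : Fin n → ℂ) :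
    ∫ x, gaussFn c b x = gaussConst c b := by
  have := GaussianFourier.integral_cexp_neg_mul_sum_add hc b
  rw [Fintype.card_fin] at this
  rw [gaussConst, ← this, ← (EuclideanSpace.volume_preserving_symm_measurableEquiv_toLp
    (Fin n)).symm.integral_comp (MeasurableEquiv.measurableEmbedding _)]
  refine integral_congr_ae (.of_forall fun x => ?_)
  simp [gaussFn, ← Complex.ofReal_pow, EuclideanSpace.norm_sq_eq]

lemma fourier_kernel_mul_gaussFn (c : ℂ) (b : Fin n → ℂ) (x ξ : EuclideanSpace ℝ (Fin n)) :
    Complex.exp (↑(-2 * Real.pi * inner ℝ x ξ) * Complex.I) * gaussFn c b x =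
      gaussFn c (fun i => b i - 2 * Real.pi * Complex.I * ξ i) x := by
  rw [gaussFn, gaussFn, ← Complex.exp_add]
  congr 1
  simp only [PiLp.inner_apply, RCLike.inner_apply, conj_trivial]
  push_cast
  rw [Finset.mul_sum, Finset.sum_mul, add_left_comm, ← Finset.sum_add_distrib]
  congr 1
  exact Finset.sum_congr rfl fun i _ => by ring

lemma fourier_gaussFn {c : ℂ} (hc : 0 < c.re) (b : Fin n → ℂ) (ξ : EuclideanSpace ℝ (Fin n)) :
    𝓕 (gaussFn c b) ξ = gaussConst c b *
      gaussFn (Real.pi ^ 2 / c) (fun i => -Complex.I * Real.pi * b i / c) ξ := by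
  have hc0 : c ≠ 0 := fun h => by simp [h] at hc
  have exponent_eq : (∑ i, (b i - 2 * Real.pi * Complex.I * ξ i) ^ 2) / (4 * c)
      = (∑ i, b i ^ 2) / (4 * c) + (-(Real.pi ^ 2 / c) * ‖ξ‖ ^ 2
        + ∑ i, -Complex.I * Real.pi * b i / c * ξ i) := by
    rw [← Complex.ofReal_pow ‖ξ‖, EuclideanSpace.real_norm_sq_eq]
    push_cast
    rw [Finset.mul_sum, Finset.sum_div, Finset.sum_div, ← Finset.sum_add_distrib,
      ← Finset.sum_add_distrib]
    refine Finset.sum_congr rfl fun i _ => ?_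
    field_simp
    linear_combination 4 * Real.pi ^ 2 * (ξ i : ℂ) ^ 2 * Complex.I_sq
  simp_rw [Real.fourier_eq', smul_eq_mul, fourier_kernel_mul_gaussFn]
  rw [integral_gaussFn hc, gaussConst, exponent_eq, Complex.exp_add, gaussConst, gaussFn, mul_assoc]

lemma norm_gaussConst_zero (c : ℂ) :
    ‖gaussConst c (0 : Fin n → ℂ)‖ = (Real.pi / ‖c‖) ^ (n / 2 : ℝ) := by
  simp only [gaussConst, Pi.zero_apply]
  rw [show (n : ℂ) / 2 = ((n / 2 : ℝ) : ℂ) by push_cast; rfl, norm_mul, Complex.norm_cpow_real]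
  simp [abs_of_pos Real.pi_pos]

end Gaussian

section Chirp

variable {V : Type*} [NormedAddCommGroup V]

/-- Multiplication by the chirp `exp (i k |x|²)`. -/
noncomputable def chirp (k : ℝ) (f : V → ℂ) (x : V) : ℂ :=
  Complex.exp (Complex.I * k * ‖x‖ ^ 2) * f x

lemma norm_chirp (k : ℝ) (f : V → ℂ) (x : V) : ‖chirp k f x‖ = ‖f x‖ := by
  have : Complex.I * k * (‖x‖ : ℂ) ^ 2 = ↑(k * ‖x‖ ^ 2) * Complex.I := by push_cast; ring
  rw [chirp, norm_mul, this, Complex.norm_exp_ofReal_mul_I, one_mul]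

lemma chirp_chirp (k l : ℝ) (f : V → ℂ) : chirp k (chirp l f) = chirp (k + l) f := by
  ext x
  simp only [chirp]
  rw [← mul_assoc, ← Complex.exp_add]
  congr 2
  push_cast
  ring

@[simp] lemma chirp_zero (f : V → ℂ) : chirp 0 f = f := by
  ext x
  simp [chirp]

variable [MeasurableSpace V] {μ : Measure V} {f g : V → ℂ}

lemma chirp_congr (h : f =ᵐ[μ] g) (k : ℝ) : chirp k f =ᵐ[μ] chirp k g :=
  h.mono fun x hx => by simp [chirp, hx]

lemma eLpNorm_chirp (k : ℝ) (f : V → ℂ) (q : ℝ≥0∞) : eLpNorm (chirp k f) q μ = eLpNorm f q μ :=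
  eLpNorm_congr_norm_ae (.of_forall fun x => norm_chirp k f x)

variable [OpensMeasurableSpace V]

lemma aestronglyMeasurable_chirp (hf : AEStronglyMeasurable f μ) (k : ℝ) :
    AEStronglyMeasurable (chirp k f) μ :=
  AEStronglyMeasurable.mul (by fun_prop) hf

lemma memLp_chirp {q : ℝ≥0∞} (hf : MemLp f q μ) (k : ℝ) : MemLp (chirp k f) q μ :=
  ⟨aestronglyMeasurable_chirp hf.1 k, by rw [eLpNorm_chirp]; exact hf.2⟩

end Chirp

section ExpLin

variable {V : Type*} [NormedAddCommGroup V] [InnerProductSpace ℝ V]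

/-- Multiplication by the real exponential `exp (ν · x)`. -/
noncomputable def expLin (ν : V) (f : V → ℂ) (x : V) : ℂ :=
  (Real.exp (inner ℝ ν x) : ℂ) * f x

lemma expLin_chirp (ν : V) (k : ℝ) (f : V → ℂ) :
    expLin ν (chirp k f) = chirp k (expLin ν f) := by
  ext x
  simp only [chirp, expLin]
  ring

lemma expLin_expLin (ν ν' : V) (f : V → ℂ) : expLin ν (expLin ν' f) = expLin (ν + ν') f := by
  ext x
  simp only [expLin]
  rw [← mul_assoc, ← Complex.ofReal_mul, ← Real.exp_add, inner_add_left]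

@[simp] lemma expLin_zero (f : V → ℂ) : expLin 0 f = f := by
  ext x
  simp [expLin]

variable [MeasurableSpace V] {μ : Measure V} {f g : V → ℂ}

lemma expLin_congr (h : f =ᵐ[μ] g) (ν : V) : expLin ν f =ᵐ[μ] expLin ν g :=
  h.mono fun x hx => by simp [expLin, hx]

lemma aestronglyMeasurable_expLin [OpensMeasurableSpace V]
    (hf : AEStronglyMeasurable f μ) (ν : V) : AEStronglyMeasurable (expLin ν f) μ :=
  AEStronglyMeasurable.mul (by fun_prop) hf

end ExpLin

section GaussTransform

variable {n : ℕ} {f g : EuclideanSpace ℝ (Fin n) → ℂ}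

/-- The pairing of `f` with the complex Gaussian `gaussFn c b`. -/
noncomputable def gaussTransform (f : EuclideanSpace ℝ (Fin n) → ℂ) (c : ℂ) (b : Fin n → ℂ) : ℂ :=
  ∫ x, f x * gaussFn c b x

/-- `f` is integrable against every complex Gaussian. This class contains `L²` and is stable
under `expLin`. -/
def GaussIntegrable (f : EuclideanSpace ℝ (Fin n) → ℂ) : Prop :=
  ∀ (c : ℂ) (b : Fin n → ℂ), 0 < c.re → Integrable (fun x => f x * gaussFn c b x)

lemma gaussIntegrable_of_memLp (hf : MemLp f 2) : GaussIntegrable f := fun _ b hc =>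
  hf.integrable_mul ((gaussSchwartz hc b).memLp 2 volume)

lemma expLin_mul_gaussFn (ν : EuclideanSpace ℝ (Fin n)) (f : EuclideanSpace ℝ (Fin n) → ℂ)
    (c : ℂ) (b : Fin n → ℂ) (x : EuclideanSpace ℝ (Fin n)) :
    expLin ν f x * gaussFn c b x = f x * gaussFn c (fun i => b i + ν i) x := by
  rw [expLin, gaussFn, gaussFn, mul_comm (Complex.ofReal _), mul_assoc, Complex.ofReal_exp,
    ← Complex.exp_add]
  congr 2
  simp only [PiLp.inner_apply, RCLike.inner_apply, conj_trivial, add_mul, Finset.sum_add_distrib]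
  push_cast
  simp only [mul_comm]
  ring

lemma chirp_mul_gaussFn (k : ℝ) (f : EuclideanSpace ℝ (Fin n) → ℂ) (c : ℂ) (b : Fin n → ℂ)
    (x : EuclideanSpace ℝ (Fin n)) :
    chirp k f x * gaussFn c b x = f x * gaussFn (c - Complex.I * k) b x := by
  rw [chirp, gaussFn, gaussFn, mul_comm (Complex.exp _), mul_assoc, ← Complex.exp_add]
  congr 2
  ring

lemma gaussTransform_expLin (ν : EuclideanSpace ℝ (Fin n)) (f : EuclideanSpace ℝ (Fin n) → ℂ)
    (c : ℂ) (b : Fin n → ℂ) :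
    gaussTransform (expLin ν f) c b = gaussTransform f c (fun i => b i + ν i) := by
  simp_rw [gaussTransform, expLin_mul_gaussFn]

lemma gaussTransform_chirp (k : ℝ) (f : EuclideanSpace ℝ (Fin n) → ℂ) (c : ℂ) (b : Fin n → ℂ) :
    gaussTransform (chirp k f) c b = gaussTransform f (c - Complex.I * k) b := by
  simp_rw [gaussTransform, chirp_mul_gaussFn]

lemma GaussIntegrable.expLin (hf : GaussIntegrable f) (ν : EuclideanSpace ℝ (Fin n)) :
    GaussIntegrable (expLin ν f) := fun c b hc => by
  simp_rw [expLin_mul_gaussFn]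
  exact hf _ _ hc

lemma gaussTransform_congr (h : f =ᵐ[volume] g) (c : ℂ) (b : Fin n → ℂ) :
    gaussTransform f c b = gaussTransform g c b :=
  integral_congr_ae (h.mono fun x hx => by simp [hx])

end GaussTransform

section FourierUniqueness

variable {V : Type*} [NormedAddCommGroup V] [InnerProductSpace ℝ V] [FiniteDimensional ℝ V]
  [MeasurableSpace V] [BorelSpace V]

lemma ae_eq_zero_of_fourier_eq_zero {f : V → ℂ} (hf : Integrable f) (h : ∀ ξ, 𝓕 f ξ = 0) :
    f =ᵐ[volume] 0 := by
  refine ae_eq_zero_of_integral_contDiff_smul_eq_zero hf.locallyIntegrable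
    fun g hg hgs => ?_
  set φ : 𝓢(V, ℂ) :=
    (hgs.comp_left (g := Complex.ofReal) rfl).toSchwartzMap (Complex.ofRealCLM.contDiff.comp hg)
  set ψ : 𝓢(V, ℂ) := 𝓕⁻ φ with hψ
  have parseval : ∫ ξ, 𝓕 f ξ * ψ ξ = ∫ x, f x * (𝓕 ψ) x := by
    simpa using! VectorFourier.integral_bilin_fourierIntegral_eq_flip (.mul ℂ ℂ)
      (L := innerₗ V) Real.continuous_fourierChar continuous_inner hf ψ.integrable
  rw [hψ, FourierTransform.fourier_fourierInv_eq] at parseval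
  calc ∫ x, g x • f x = ∫ x, f x * φ x :=
        integral_congr_ae (.of_forall fun x => by
          change g x • f x = f x * (g x : ℂ)
          rw [mul_comm, Complex.real_smul])
    _ = 0 := by simp [← parseval, h]

end FourierUniqueness

section GaussUniqueness

variable {n : ℕ} {f g : EuclideanSpace ℝ (Fin n) → ℂ}

lemma ae_eq_of_gaussTransform_eq (hf : GaussIntegrable f) (hg : GaussIntegrable g) {c : ℂ}
    (hc : 0 < c.re) (κ : ℂ) (h : ∀ b, gaussTransform f c b = κ * gaussTransform g c b) :
    f =ᵐ[volume] fun x => κ * g x := by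
  have integrable_sub : Integrable (fun x => (f x - κ * g x) * gaussFn c 0 x) := by
    simp_rw [sub_mul, mul_assoc]
    exact (hf c 0 hc).sub ((hg c 0 hc).const_mul κ)
  have vanish := ae_eq_zero_of_fourier_eq_zero integrable_sub fun ξ => by
    simp_rw [Real.fourier_eq', smul_eq_mul, mul_left_comm _ (_ - _), fourier_kernel_mul_gaussFn,
      sub_mul, mul_assoc κ]
    rw [integral_sub (hf _ _ hc) ((hg _ _ hc).const_mul κ), integral_const_mul, sub_eq_zero]
    exact h _
  filter_upwards [vanish] with x hx
  exact sub_eq_zero.mp ((mul_eq_zero.mp hx).resolve_right (Complex.exp_ne_zero _))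

lemma integral_fourier_mul (q : L2 n) (φ : 𝓢(EuclideanSpace ℝ (Fin n), ℂ)) :
    ∫ x, (𝓕 q : L2 n) x * φ x = ∫ x, q x * 𝓕 φ x := by
  have := congrArg (fun T => T φ) (Lp.fourier_toTemperedDistribution_eq q)
  simp only [TemperedDistribution.fourier_apply, Lp.toTemperedDistribution_apply,
    smul_eq_mul] at this
  simp_rw [mul_comm _ (φ _), mul_comm _ (𝓕 φ _)]
  exact this.symm

lemma pi_sq_div_re_pos {c : ℂ} (hc : 0 < c.re) : 0 < ((Real.pi : ℂ) ^ 2 / c).re := by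
  rw [← Complex.ofReal_pow, div_eq_mul_inv, Complex.re_ofReal_mul, Complex.inv_re]
  have := Complex.normSq_pos.mpr fun h : c = 0 => by simp [h] at hc
  positivity

lemma gaussTransform_fourier (q : L2 n) {c : ℂ} (hc : 0 < c.re) (b : Fin n → ℂ) :
    gaussTransform (𝓕 q : L2 n) c b = gaussConst c b *
      gaussTransform q (Real.pi ^ 2 / c) (fun i => -Complex.I * Real.pi * b i / c) := by
  have fourier_gaussSchwartz (x : EuclideanSpace ℝ (Fin n)) :
      (𝓕 (gaussSchwartz hc b)) x = 𝓕 (gaussFn c b) x := rfl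
  have parseval := integral_fourier_mul q (gaussSchwartz hc b)
  simp_rw [fourier_gaussSchwartz, fourier_gaussFn hc, coe_gaussSchwartz, mul_left_comm (q _),
    integral_const_mul] at parseval
  exact parseval

end GaussUniqueness

section Calculus

lemma hasDerivAt_pairing {E F G : Type*} [NormedAddCommGroup E] [NormedSpace ℝ E]
    [NormedAddCommGroup F] [NormedSpace ℝ F] [NormedAddCommGroup G] [NormedSpace ℝ G]
    (B : E →L[ℝ] F →L[ℝ] G) {w : ℝ → E} {Φ : ℝ → F} {Φ' : F} {d : G} {s : ℝ}
    (hw : ContinuousAt w s) (hΦ : HasDerivAt Φ Φ' s)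
    (hd : HasDerivAt (fun r => B (w r) (Φ s)) d s) :
    HasDerivAt (fun r => B (w r) (Φ r)) (d + B (w s) Φ') s := by
  rw [hasDerivAt_iff_tendsto_slope] at hΦ hd ⊢
  have slope_right : Filter.Tendsto (fun r => B (w r) (slope Φ s r)) (nhdsWithin s {s}ᶜ)
      (nhds (B (w s) Φ')) :=
    B.isBoundedBilinearMap.continuous.continuousAt.tendsto.comp
      ((hw.tendsto.mono_left nhdsWithin_le_nhds).prodMk_nhds hΦ)
  refine (hd.add slope_right).congr fun r => ?_
  simp only [slope_def_module, map_smul, map_sub]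
  rw [← smul_add]
  congr 1
  abel

lemma eq_of_hasDerivAt_zero_Ioi {G : Type*} [NormedAddCommGroup G] [NormedSpace ℝ G] {F : ℝ → G}
    {a b : ℝ} (hab : a ≤ b) (hF : ContinuousOn F (Ici a))
    (hderiv : ∀ s, a < s → HasDerivAt F 0 s) : F b = F a := by
  rcases hab.eq_or_lt with rfl | hab
  · rfl
  have const_right : ∀ s ∈ Ioc a b, F b = F s := fun s hs =>
    constant_of_has_deriv_right_zero (hF.mono fun x hx => hs.1.le.trans hx.1)
      (fun x hx => (hderiv x (hs.1.trans_le hx.1)).hasDerivWithinAt) b ⟨hs.2, le_rfl⟩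
  exact tendsto_nhds_unique
    (tendsto_const_nhds.congr' (Filter.eventually_of_mem (Ioc_mem_nhdsGT hab) const_right))
    ((hF a self_mem_Ici).mono_left (nhdsWithin_mono _ Ioi_subset_Ici_self))

lemma norm_exp_I_mul_sub_one_sub_le (x : ℝ) :
    ‖Complex.exp (Complex.I * x) - 1 - Complex.I * x‖ ≤ 2 * x ^ 2 := by
  have norm_I_mul : ‖Complex.I * (x : ℂ)‖ = |x| := by simp
  rcases le_total |x| 1 with h | h
  · have := Complex.norm_exp_sub_one_sub_id_le (x := Complex.I * x) (by rwa [norm_I_mul])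
    rw [norm_I_mul, sq_abs] at this
    linarith [sq_nonneg x]
  · calc _ ≤ ‖Complex.exp (Complex.I * x) - 1‖ + ‖Complex.I * x‖ := norm_sub_le _ _
      _ ≤ |x| + |x| := by
        rw [norm_I_mul]
        gcongr
        exact Real.norm_exp_I_mul_ofReal_sub_one_le
      _ ≤ 2 * x ^ 2 := by rw [← sq_abs]; nlinarith

end Calculus

section SchwartzL2

variable {V : Type*} [NormedAddCommGroup V]

/-- Multiplication of a Schwartz function by `|x|²`. -/
noncomputable def normSqSchwartz [InnerProductSpace ℝ V] (φ : 𝓢(V, ℂ)) : 𝓢(V, ℂ) :=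
  SchwartzMap.smulLeftCLM ℂ ((‖·‖ ^ 2) : V → ℝ) φ

@[simp] lemma normSqSchwartz_apply [InnerProductSpace ℝ V] (φ : 𝓢(V, ℂ)) (x : V) :
    normSqSchwartz φ x = (‖x‖ : ℂ) ^ 2 * φ x := by
  rw [normSqSchwartz, SchwartzMap.smulLeftCLM_apply_apply (g := fun x => ‖x‖ ^ 2)
    (Function.hasTemperateGrowth_norm_sq V)]
  simp

lemma norm_toLp_le_of_norm_le [NormedSpace ℝ V] [MeasurableSpace V] [OpensMeasurableSpace V]
    [SecondCountableTopology V] {μ : Measure V} [μ.HasTemperateGrowth] {p : ℝ≥0∞}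
    {φ ψ : 𝓢(V, ℂ)} {C : ℝ} (h : ∀ x, ‖φ x‖ ≤ C * ‖ψ x‖) :
    ‖φ.toLp p μ‖ ≤ C * ‖ψ.toLp p μ‖ := by
  refine Lp.norm_le_mul_norm_of_ae_le_mul ?_
  filter_upwards [φ.coeFn_toLp p μ, ψ.coeFn_toLp p μ] with x hφ hψ
  rw [hφ, hψ]
  exact h x

variable [InnerProductSpace ℝ V] [FiniteDimensional ℝ V] [MeasurableSpace V] [BorelSpace V]

lemma laplacian_fourierInv (φ : 𝓢(V, ℂ)) :
    Δ (𝓕⁻ φ) = -(2 * Real.pi) ^ 2 • 𝓕⁻ (normSqSchwartz φ) := by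
  rw [SchwartzMap.laplacian_eq_fourierMultiplierCLM, SchwartzMap.fourierMultiplierCLM_apply,
    FourierTransform.fourier_fourierInv_eq]
  rfl

end SchwartzL2

section GaussPath

variable {n : ℕ} {c : ℂ}

lemma sub_I_mul_re_pos (hc : 0 < c.re) (s : ℝ) : 0 < (c - Complex.I * s).re := by
  simpa using hc

/-- The Gaussian `exp (-(c - i s) |x|² + b · x)` as a Schwartz function: a Gaussian transported by
the Schrödinger evolution on the Fourier side. -/
noncomputable def gaussEvolution (hc : 0 < c.re) (b : Fin n → ℂ) (s : ℝ) :
    𝓢(EuclideanSpace ℝ (Fin n), ℂ) :=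
  gaussSchwartz (sub_I_mul_re_pos hc s) b

lemma gaussEvolution_add_apply (hc : 0 < c.re) (b : Fin n → ℂ) (s h : ℝ)
    (x : EuclideanSpace ℝ (Fin n)) :
    gaussEvolution hc b (s + h) x =
      Complex.exp (Complex.I * (h * ‖x‖ ^ 2 : ℝ)) * gaussEvolution hc b s x := by
  rw [gaussEvolution, gaussEvolution, coe_gaussSchwartz, coe_gaussSchwartz, gaussFn, gaussFn,
    ← Complex.exp_add]
  congr 1
  push_cast
  ring

lemma norm_gaussEvolution_taylor_le (hc : 0 < c.re) (b : Fin n → ℂ) (s h : ℝ)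
    (x : EuclideanSpace ℝ (Fin n)) :
    ‖(gaussEvolution hc b (s + h) - gaussEvolution hc b s -
      h • Complex.I • normSqSchwartz (gaussEvolution hc b s)) x‖ ≤
      2 * h ^ 2 * ‖normSqSchwartz (normSqSchwartz (gaussEvolution hc b s)) x‖ := by
  have factor : (gaussEvolution hc b (s + h) - gaussEvolution hc b s -
      h • Complex.I • normSqSchwartz (gaussEvolution hc b s)) x =
      (Complex.exp (Complex.I * (h * ‖x‖ ^ 2 : ℝ)) - 1 - Complex.I * (h * ‖x‖ ^ 2 : ℝ)) *
        gaussEvolution hc b s x := by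
    simp only [_root_.sub_apply, _root_.smul_apply, normSqSchwartz_apply,
      gaussEvolution_add_apply, Complex.real_smul, smul_eq_mul]
    push_cast
    ring
  calc _ ≤ 2 * (h * ‖x‖ ^ 2) ^ 2 * ‖gaussEvolution hc b s x‖ := by
        rw [factor, norm_mul]
        gcongr
        exact norm_exp_I_mul_sub_one_sub_le _
    _ = _ := by
        simp only [normSqSchwartz_apply, norm_mul, norm_pow, Complex.norm_real, norm_norm]
        ring

lemma hasDerivAt_toLp_gaussEvolution (hc : 0 < c.re) (b : Fin n → ℂ) (s : ℝ) :
    HasDerivAt (fun r => (gaussEvolution hc b r).toLp 2 volume)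
      (Complex.I • (normSqSchwartz (gaussEvolution hc b s)).toLp 2 volume) s := by
  rw [hasDerivAt_iff_isLittleO_nhds_zero]
  refine Asymptotics.IsBigO.trans_isLittleO (.of_bound
    (2 * ‖(normSqSchwartz (normSqSchwartz (gaussEvolution hc b s))).toLp 2 volume‖)
    (.of_forall fun h => ?_)) (by simpa using Asymptotics.isLittleO_pow_id (𝕜 := ℝ) one_lt_two)
  rw [norm_pow, Real.norm_eq_abs, sq_abs, mul_right_comm]
  have remainder_toLp := norm_toLp_le_of_norm_le (p := 2) (μ := volume)
    (norm_gaussEvolution_taylor_le hc b s h)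
  simp only [← SchwartzMap.toLpCLM_apply (𝕜 := ℂ), map_sub, map_smul,
    ContinuousLinearMap.map_smul_of_tower] at remainder_toLp
  exact remainder_toLp

end GaussPath

section FourierSideEquation

variable {n : ℕ}

/-- The bilinear pairing `∫ f g` on `L²`. -/
noncomputable def l2Pairing (n : ℕ) : L2 n →L[ℝ] L2 n →L[ℝ] ℂ :=
  (ContinuousLinearMap.mul ℝ ℂ).lpPairing volume 2 2

lemma l2Pairing_apply (f g : L2 n) : l2Pairing n f g = ∫ x, f x * g x := by
  rw [l2Pairing, ContinuousLinearMap.lpPairing_eq_integral]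
  rfl

lemma l2Pairing_toLp (f : L2 n) (φ : 𝓢(EuclideanSpace ℝ (Fin n), ℂ)) :
    l2Pairing n f (φ.toLp 2) = ∫ x, f x * φ x := by
  rw [l2Pairing_apply]
  refine integral_congr_ae ((φ.coeFn_toLp 2 volume).mono fun x hx => ?_)
  simp only [hx]

lemma l2Pairing_smul_right (f g : L2 n) (z : ℂ) :
    l2Pairing n f (z • g) = z * l2Pairing n f g := by
  rw [l2Pairing_apply, l2Pairing_apply, ← integral_const_mul]
  refine integral_congr_ae ((Lp.coeFn_smul z g).mono fun x hx => ?_)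
  simp only [hx, Pi.smul_apply, smul_eq_mul]
  ring

lemma integral_fourierInv_mul (q : L2 n) (φ : 𝓢(EuclideanSpace ℝ (Fin n), ℂ)) :
    ∫ x, (𝓕⁻ q : L2 n) x * φ x = ∫ x, q x * (𝓕⁻ φ) x := by
  have parseval := integral_fourier_mul (𝓕⁻ q) (𝓕⁻ φ)
  rw [FourierTransform.fourier_fourierInv_eq] at parseval
  have fourier_inv : (𝓕 (𝓕⁻ φ) : 𝓢(EuclideanSpace ℝ (Fin n), ℂ)) = φ :=
    FourierTransform.fourier_fourierInv_eq φ
  rw [parseval, fourier_inv]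

namespace IsFreeSchrodingerSolution

variable {u₀ : L2 n} {u : ℝ → L2 n}

lemma continuousOn_fourierInv (hu : IsFreeSchrodingerSolution u₀ u) :
    ContinuousOn (fun s => (𝓕⁻ (u s) : L2 n)) (Ici 0) :=
  (Lp.fourierTransformₗᵢ (EuclideanSpace ℝ (Fin n)) ℂ).symm.continuous.comp_continuousOn
    hu.continuousOn

lemma hasDerivAt_fourierInv (hu : IsFreeSchrodingerSolution u₀ u)
    (φ : 𝓢(EuclideanSpace ℝ (Fin n), ℂ)) {t : ℝ} (ht : 0 < t) :
    HasDerivAt (fun s => l2Pairing n (𝓕⁻ (u s)) (φ.toLp 2))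
      (-(2 * Real.pi) ^ 2 * Complex.I *
        l2Pairing n (𝓕⁻ (u t)) ((normSqSchwartz φ).toLp 2)) t := by
  simp_rw [l2Pairing_toLp, integral_fourierInv_mul]
  convert! hu.equation (𝓕⁻ φ) t ht using 1
  rw [laplacian_fourierInv, mul_comm _ Complex.I, mul_assoc, ← integral_const_mul]
  congr 2
  ext x
  rw [_root_.smul_apply, Complex.real_smul]
  push_cast
  ring

lemma l2Pairing_gaussEvolution_eq (hu : IsFreeSchrodingerSolution u₀ u) {c : ℂ} (hc : 0 < c.re)
    (b : Fin n → ℂ) {t : ℝ} (ht : 0 ≤ t) :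
    l2Pairing n (𝓕⁻ (u t)) ((gaussEvolution hc b ((2 * Real.pi) ^ 2 * t)).toLp 2) =
      l2Pairing n (𝓕⁻ u₀) ((gaussEvolution hc b 0).toLp 2) := by
  have hasDerivAt_test (s : ℝ) :=
    (hasDerivAt_toLp_gaussEvolution hc b ((2 * Real.pi) ^ 2 * s)).scomp s
      ((hasDerivAt_id s).const_mul ((2 * Real.pi) ^ 2))
  have continuous_test := continuous_iff_continuousAt.mpr fun s => (hasDerivAt_test s).continuousAt
  have conserved := eq_of_hasDerivAt_zero_Ioi ht
    (((l2Pairing n).continuous.comp_continuousOn hu.continuousOn_fourierInv).clm_apply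
      continuous_test.continuousOn) fun s hs => by
    convert! hasDerivAt_pairing (l2Pairing n)
      (hu.continuousOn_fourierInv.continuousAt (Ici_mem_nhds hs)) (hasDerivAt_test s)
      (hu.hasDerivAt_fourierInv _ hs) using 1
    rw [map_smul, l2Pairing_smul_right, Complex.real_smul]
    push_cast
    ring
  simpa [hu.initial] using conserved

theorem fourierInv_ae_eq (hu : IsFreeSchrodingerSolution u₀ u) {t : ℝ} (ht : 0 ≤ t) :
    (𝓕⁻ (u t) : L2 n) =ᵐ[volume] chirp (-(2 * Real.pi) ^ 2 * t) (𝓕⁻ u₀ : L2 n) := by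
  have gaussTransform_eq (c : ℂ) (hc : 0 < c.re) (b : Fin n → ℂ) :
      gaussTransform (𝓕⁻ (u t) : L2 n) (c - Complex.I * ((2 * Real.pi) ^ 2 * t : ℝ)) b =
        gaussTransform (𝓕⁻ u₀ : L2 n) c b := by
    have := hu.l2Pairing_gaussEvolution_eq hc b ht
    simpa [l2Pairing_toLp, gaussEvolution, gaussTransform] using this
  set κ : ℝ := (2 * Real.pi) ^ 2 * t
  have := ae_eq_of_gaussTransform_eq (gaussIntegrable_of_memLp (Lp.memLp (𝓕⁻ (u t) : L2 n)))
    (gaussIntegrable_of_memLp (memLp_chirp (Lp.memLp (𝓕⁻ u₀ : L2 n)) (-κ))) (c := 1) (by simp) 1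
    fun b => by
      rw [gaussTransform_chirp, one_mul, ← gaussTransform_eq _ (by simp) b]
      congr 1
      push_cast
      ring
  simpa [κ] using this

end IsFreeSchrodingerSolution

end FourierSideEquation

section Laplace

variable {V : Type*} [NormedAddCommGroup V] [InnerProductSpace ℝ V] [MeasurableSpace V]

lemma laplaceTransform_map_smul [BorelSpace V] (μ : Measure V) (r : ℝ) (l : V) :
    laplaceTransform (μ.map (r • ·)) l = laplaceTransform μ (r • l) := by
  rw [laplaceTransform, laplaceTransform, lintegral_map (by fun_prop) (by fun_prop)]
  simp_rw [real_inner_smul_left, real_inner_smul_right]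

variable [OpensMeasurableSpace V]

lemma laplaceTransform_smul_le (μ : Measure V) (l : V) {s : ℝ} (hs : s ∈ Icc (0 : ℝ) 1) :
    laplaceTransform μ (s • l) ≤ laplaceTransform μ 0 ^ (1 - s) * laplaceTransform μ l ^ s := by
  have weight (x : V) : ENNReal.ofReal (Real.exp (inner ℝ (s • l) x)) =
      ENNReal.ofReal (Real.exp (inner ℝ 0 x)) ^ (1 - s) *
        ENNReal.ofReal (Real.exp (inner ℝ l x)) ^ s := by
    rw [ENNReal.ofReal_rpow_of_pos (Real.exp_pos (inner ℝ l x)), ← Real.exp_mul]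
    simp [real_inner_smul_left, mul_comm]
  simp_rw [laplaceTransform, weight]
  exact ENNReal.lintegral_mul_norm_pow_le (by fun_prop) (by fun_prop) (sub_nonneg.mpr hs.2) hs.1
    (by ring)

lemma laplaceTransform_eq_zero_iff {μ : Measure V} {l : V} :
    laplaceTransform μ l = 0 ↔ μ = 0 := by
  rw [laplaceTransform, lintegral_eq_zero_iff (by fun_prop), Filter.EventuallyEq]
  simp [not_le.mpr (Real.exp_pos _)]

end Laplace

section NormSqMeasure

/-- The measure with density `|f|²`. Weighted `L²` norms of `f` are integrals against it. -/
noncomputable def normSqMeasure {X : Type*} [MeasureSpace X] (f : X → ℂ) : Measure X :=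
  volume.withDensity fun x => ‖f x‖ₑ ^ 2

instance {X : Type*} [MeasureSpace X] [SFinite (volume : Measure X)] (f : X → ℂ) :
    SFinite (normSqMeasure f) :=
  inferInstanceAs (SFinite (volume.withDensity _))

lemma eLpNorm_real_exp_mul_sq {X : Type*} [MeasureSpace X] {f : X → ℂ} {g : X → ℝ}
    (hf : AEStronglyMeasurable f volume) (hg : Measurable g) :
    eLpNorm (fun x => (Real.exp (g x) : ℂ) * f x) 2 volume ^ 2 =
      ∫⁻ x, ENNReal.ofReal (Real.exp (2 * g x)) ∂normSqMeasure f := by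
  have enorm_sq (x : X) : ‖(Real.exp (g x) : ℂ) * f x‖ₑ ^ 2 =
      ‖f x‖ₑ ^ 2 * ENNReal.ofReal (Real.exp (2 * g x)) := by
    rw [enorm_mul, mul_pow, mul_comm, ← ofReal_norm (Real.exp _ : ℂ), Complex.norm_real,
      Real.norm_eq_abs, Real.abs_exp, ← ENNReal.ofReal_pow (Real.exp_pos _).le, ← Real.exp_nat_mul]
    simp
  have := eLpNorm_nnreal_pow_eq_lintegral (μ := volume)
    (f := fun x => (Real.exp (g x) : ℂ) * f x) (p := 2) two_ne_zero
  simp only [NNReal.coe_ofNat, ENNReal.coe_ofNat, ENNReal.rpow_ofNat, enorm_sq] at this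
  rw [this, normSqMeasure, lintegral_withDensity_eq_lintegral_mul₀ (hf.enorm.pow_const 2)
    (by fun_prop)]
  rfl

lemma laplaceTransform_normSqMeasure {V : Type*} [NormedAddCommGroup V] [InnerProductSpace ℝ V]
    [MeasureSpace V] [OpensMeasurableSpace V] {f : V → ℂ} (hf : AEStronglyMeasurable f volume)
    (ν : V) :
    laplaceTransform (normSqMeasure f) ((2 : ℝ) • ν) = eLpNorm (expLin ν f) 2 volume ^ 2 := by
  simp_rw [laplaceTransform, real_inner_smul_left]
  exact (eLpNorm_real_exp_mul_sq hf (by fun_prop)).symm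

lemma normSqMeasure_eq_zero_iff {n : ℕ} {f : L2 n} : normSqMeasure f = 0 ↔ f = 0 := by
  rw [normSqMeasure, withDensity_eq_zero_iff ((Lp.aestronglyMeasurable f).enorm.pow_const 2),
    Lp.eq_zero_iff_ae_eq_zero, Filter.EventuallyEq, Filter.EventuallyEq]
  simp

end NormSqMeasure

section ImaginaryTranslation

variable {n : ℕ}

/-- The factor `exp (i β · η / 2π + d |η|² / 4π²)` by which the pairing with `exp (-d |x|² + β · x)`
changes under translation by `i η / 2π`. -/
noncomputable def translationFactor (η : EuclideanSpace ℝ (Fin n)) (d : ℂ) (β : Fin n → ℂ) : ℂ :=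
  Complex.exp (Complex.I * (∑ i, β i * η i) / (2 * Real.pi) +
    d * (∑ i, (η i : ℂ) ^ 2) / (4 * Real.pi ^ 2))

lemma gaussConst_ne_zero {c : ℂ} (hc : c ≠ 0) (b : Fin n → ℂ) : gaussConst c b ≠ 0 := by
  have hpi : (Real.pi : ℂ) ≠ 0 := by exact_mod_cast Real.pi_ne_zero
  exact mul_ne_zero (by simp [Complex.cpow_eq_zero_iff, hpi, hc]) (Complex.exp_ne_zero _)

lemma gaussConst_add {d : ℂ} (hd : d ≠ 0) (η : EuclideanSpace ℝ (Fin n)) (β : Fin n → ℂ) :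
    gaussConst (Real.pi ^ 2 / d) (fun i => Complex.I * Real.pi * β i / d + η i) =
      gaussConst (Real.pi ^ 2 / d) (fun i => Complex.I * Real.pi * β i / d) *
        translationFactor η d β := by
  rw [gaussConst, gaussConst, translationFactor, mul_assoc, ← Complex.exp_add]
  congr 2
  simp only [Finset.sum_div, Finset.mul_sum, ← Finset.sum_add_distrib]
  refine Finset.sum_congr rfl fun i _ => ?_
  field_simp
  ring

lemma gaussTransform_expLin_fourier (q : L2 n) (η : EuclideanSpace ℝ (Fin n)) {d : ℂ}
    (hd : 0 < d.re) (β : Fin n → ℂ) :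
    gaussTransform (expLin η (𝓕 q : L2 n)) (Real.pi ^ 2 / d)
        (fun i => Complex.I * Real.pi * β i / d) =
      gaussConst (Real.pi ^ 2 / d) (fun i => Complex.I * Real.pi * β i / d) *
        (translationFactor η d β *
          gaussTransform q d (fun i => β i - Complex.I * d * η i / Real.pi)) := by
  have hd0 : d ≠ 0 := fun h => by simp [h] at hd
  rw [gaussTransform_expLin, gaussTransform_fourier q (pi_sq_div_re_pos hd), gaussConst_add hd0,
    mul_assoc]
  congr 3
  · field_simp
  · ext i
    field_simp
    linear_combination -Real.pi * β i * Complex.I_sq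

theorem fourier_ae_eq_expLin_fourier_iff (f g : L2 n) (η : EuclideanSpace ℝ (Fin n)) (κ : ℂ)
    {d : ℂ} (hd : 0 < d.re) :
    (𝓕 f : L2 n) =ᵐ[volume] (fun x => κ * expLin η (𝓕 g : L2 n) x) ↔
      ∀ β, gaussTransform f d β = κ * (translationFactor η d β *
        gaussTransform g d (fun i => β i - Complex.I * d * η i / Real.pi)) := by
  have hd0 : d ≠ 0 := fun h => by simp [h] at hd
  have hpi : (Real.pi : ℂ) ≠ 0 := by exact_mod_cast Real.pi_ne_zero
  have gaussTransform_eq (β : Fin n → ℂ) := gaussTransform_expLin_fourier f 0 hd β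
  simp only [expLin_zero, translationFactor, PiLp.zero_apply, Complex.ofReal_zero, mul_zero,
    Finset.sum_const_zero, zero_div, add_zero, zero_pow two_ne_zero, Complex.exp_zero, one_mul,
    sub_zero] at gaussTransform_eq
  have gaussTransform_const_mul (b : Fin n → ℂ) :
      gaussTransform (fun x => κ * expLin η (𝓕 g : L2 n) x) (Real.pi ^ 2 / d) b =
        κ * gaussTransform (expLin η (𝓕 g : L2 n)) (Real.pi ^ 2 / d) b := by
    simp_rw [gaussTransform, mul_assoc, integral_const_mul]
  constructor
  · intro h β
    refine mul_left_cancel₀ (gaussConst_ne_zero (c := Real.pi ^ 2 / d) (by simp [hpi, hd0])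
      fun i => Complex.I * Real.pi * β i / d) ?_
    rw [← gaussTransform_eq, gaussTransform_congr h, gaussTransform_const_mul,
      gaussTransform_expLin_fourier g η hd, mul_left_comm]
  · intro h
    refine ae_eq_of_gaussTransform_eq (gaussIntegrable_of_memLp (Lp.memLp _))
      ((gaussIntegrable_of_memLp (Lp.memLp _)).expLin η) (pi_sq_div_re_pos hd) κ fun b => ?_
    obtain ⟨β, rfl⟩ : ∃ β : Fin n → ℂ, b = fun i => Complex.I * Real.pi * β i / d :=
      ⟨fun i => -Complex.I * d * b i / Real.pi, by
        ext i
        field_simp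
        linear_combination b i * Complex.I_sq⟩
    rw [gaussTransform_eq, h, gaussTransform_expLin_fourier g η hd, mul_left_comm]

end ImaginaryTranslation

section ChirpedFourier

variable {n : ℕ}

/-- The chirp multiplication on `L²`. -/
noncomputable def chirpLp (k : ℝ) (f : L2 n) : L2 n := (memLp_chirp (Lp.memLp f) k).toLp _

lemma coeFn_chirpLp (k : ℝ) (f : L2 n) : chirpLp k f =ᵐ[volume] chirp k f := MemLp.coeFn_toLp _

lemma chirpLp_chirpLp (k l : ℝ) (f : L2 n) : chirpLp k (chirpLp l f) = chirpLp (k + l) f := by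
  refine Lp.ext ((coeFn_chirpLp _ _).trans ((chirp_congr (coeFn_chirpLp l f) _).trans ?_))
  rw [chirp_chirp]
  exact (coeFn_chirpLp _ _).symm

@[simp] lemma chirpLp_zero (f : L2 n) : chirpLp 0 f = f :=
  Lp.ext ((coeFn_chirpLp _ _).trans (by rw [chirp_zero]))

lemma gaussTransform_chirpLp (k : ℝ) (f : L2 n) (c : ℂ) (b : Fin n → ℂ) :
    gaussTransform (chirpLp k f) c b = gaussTransform f (c - Complex.I * k) b := by
  rw [gaussTransform_congr (coeFn_chirpLp k f), gaussTransform_chirp]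

lemma norm_chirpLp (k : ℝ) (f : L2 n) : ‖chirpLp k f‖ = ‖f‖ := by
  rw [Lp.norm_def, Lp.norm_def, eLpNorm_congr_ae (coeFn_chirpLp k f), eLpNorm_chirp]

lemma eLpNorm_fourier (f : L2 n) : eLpNorm (𝓕 f : L2 n) 2 volume = eLpNorm f 2 volume := by
  rw [← Lp.enorm_def, ← Lp.enorm_def, ← ofReal_norm, ← ofReal_norm, Lp.norm_fourier_eq]

lemma fourier_chirpLp_eq_zero_iff {k : ℝ} {f : L2 n} : (𝓕 (chirpLp k f) : L2 n) = 0 ↔ f = 0 := by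
  rw [← norm_eq_zero, Lp.norm_fourier_eq, norm_chirpLp, norm_eq_zero]

lemma translationFactor_sub_I_mul (η : EuclideanSpace ℝ (Fin n)) (k : ℝ) (d : ℂ)
    (β : Fin n → ℂ) :
    translationFactor η d β =
      Complex.exp ((k * (∑ i, η i ^ 2) / (4 * Real.pi ^ 2) : ℝ) * Complex.I) *
        translationFactor η (d - Complex.I * k) β := by
  rw [translationFactor, translationFactor, ← Complex.exp_add]
  congr 1
  push_cast
  ring

lemma exists_fourier_chirpLp_ae_eq_expLin {k : ℝ} (hk : k ≠ 0) (ν : EuclideanSpace ℝ (Fin n))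
    {f g v : L2 n} (hg : g =ᵐ[volume] expLin ν v)
    (hf : (𝓕 f : L2 n) =ᵐ[volume] expLin ((Real.pi / k) • ν) (𝓕 g : L2 n)) :
    ∃ κ : ℂ, ‖κ‖ₑ = 1 ∧ (𝓕 (chirpLp k f) : L2 n) =ᵐ[volume] fun x =>
      κ * expLin ((Real.pi / k) • ν) (𝓕 (chirpLp k v) : L2 n) x := by
  set η := (Real.pi / k) • ν with hη
  set phase := Complex.exp ((k * (∑ i, η i ^ 2) / (4 * Real.pi ^ 2) : ℝ) * Complex.I)
  refine ⟨phase⁻¹, by rw [← ofReal_norm, norm_inv, Complex.norm_exp_ofReal_mul_I]; simp, ?_⟩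
  refine (fourier_ae_eq_expLin_fourier_iff _ _ η _ (d := 1) (by simp)).mpr fun β => ?_
  have translate_f := (fourier_ae_eq_expLin_fourier_iff f g η 1 (d := 1 - Complex.I * k)
    (by simp)).mp (by simpa using hf) β
  rw [gaussTransform_chirpLp, gaussTransform_chirpLp, translate_f, gaussTransform_congr hg,
    gaussTransform_expLin, translationFactor_sub_I_mul η k 1 β, one_mul, mul_assoc,
    inv_mul_cancel_left₀ (Complex.exp_ne_zero _)]
  congr 2
  ext i
  have hkℂ : (k : ℂ) ≠ 0 := mod_cast hk
  simp only [hη, PiLp.smul_apply, smul_eq_mul]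
  push_cast
  field_simp
  linear_combination (k * ν i) * Complex.I_sq

lemma eLpNorm_expLin_fourier_chirpLp_le {k : ℝ} (hk : k ≠ 0) (ν : EuclideanSpace ℝ (Fin n))
    {g v : L2 n} (hg : g =ᵐ[volume] expLin ν v) :
    eLpNorm (expLin ((Real.pi / k) • ν) (𝓕 (chirpLp k v) : L2 n)) 2 volume ≤
      eLpNorm (expLin ((Real.pi / k) • ν) (𝓕 g : L2 n)) 2 volume := by
  set η := (Real.pi / k) • ν
  by_cases htop : eLpNorm (expLin η (𝓕 g : L2 n)) 2 volume = ∞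
  · exact htop ▸ le_top
  have memLp : MemLp (expLin η (𝓕 g : L2 n)) 2 :=
    ⟨aestronglyMeasurable_expLin (Lp.aestronglyMeasurable _) η, lt_top_iff_ne_top.mpr htop⟩
  obtain ⟨f, fourier_f⟩ : ∃ f : L2 n, (𝓕 f : L2 n) =ᵐ[volume] expLin η (𝓕 g : L2 n) :=
    ⟨𝓕⁻ memLp.toLp, by
      rw [FourierTransform.fourier_fourierInv_eq]
      exact memLp.coeFn_toLp⟩
  obtain ⟨κ, norm_κ, translate⟩ := exists_fourier_chirpLp_ae_eq_expLin hk ν hg fourier_f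
  refine le_of_eq ?_
  calc eLpNorm (expLin η (𝓕 (chirpLp k v) : L2 n)) 2 volume
      = eLpNorm (κ • expLin η (𝓕 (chirpLp k v) : L2 n)) 2 volume := by
        rw [eLpNorm_const_smul, norm_κ, one_mul]
    _ = eLpNorm (𝓕 (chirpLp k f) : L2 n) 2 volume := (eLpNorm_congr_ae translate).symm
    _ = eLpNorm (expLin η (𝓕 g : L2 n)) 2 volume := by
        rw [eLpNorm_fourier, eLpNorm_congr_ae (coeFn_chirpLp k f), eLpNorm_chirp,
          ← eLpNorm_fourier, eLpNorm_congr_ae fourier_f]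

lemma eLpNorm_expLin_fourier_chirpLp {k : ℝ} (hk : k ≠ 0) (ν : EuclideanSpace ℝ (Fin n))
    {g v : L2 n} (hg : g =ᵐ[volume] expLin ν v) :
    eLpNorm (expLin ((Real.pi / k) • ν) (𝓕 (chirpLp k v) : L2 n)) 2 volume =
      eLpNorm (expLin ((Real.pi / k) • ν) (𝓕 g : L2 n)) 2 volume := by
  refine le_antisymm (eLpNorm_expLin_fourier_chirpLp_le hk ν hg) ?_
  have chirp_eq : chirpLp k v =ᵐ[volume] expLin (-ν) (chirpLp k g) := by
    refine (coeFn_chirpLp k v).trans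
      (.trans ?_ (expLin_congr ((coeFn_chirpLp k g).trans (chirp_congr hg k)) (-ν)).symm)
    rw [expLin_chirp, expLin_expLin, neg_add_cancel, expLin_zero]
  have reverse := eLpNorm_expLin_fourier_chirpLp_le (neg_ne_zero.mpr hk) (-ν) chirp_eq
  rwa [chirpLp_chirpLp, neg_add_cancel, chirpLp_zero, div_neg, neg_smul_neg] at reverse

lemma laplaceTransform_fourier_chirpLp_le_of_ne_top (v : L2 n) {k k' : ℝ} (hk' : 0 < k')
    (hkk' : k' ≤ k) {ν : EuclideanSpace ℝ (Fin n)}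
    (hν : laplaceTransform (normSqMeasure v) ((2 : ℝ) • ν) ≠ ∞) :
    laplaceTransform (normSqMeasure (𝓕 (chirpLp k v) : L2 n)) ((Real.pi / k) • (2 : ℝ) • ν) ≤
      laplaceTransform (normSqMeasure v) ((2 : ℝ) • ν) ^ (1 - k' / k) *
        laplaceTransform (normSqMeasure (𝓕 (chirpLp k' v) : L2 n))
          ((Real.pi / k') • (2 : ℝ) • ν) ^ (k' / k) := by
  have hk : 0 < k := hk'.trans_le hkk'
  have meas (f : L2 n) := Lp.aestronglyMeasurable f
  rw [laplaceTransform_normSqMeasure (meas v)] at hν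
  have memLp : MemLp (expLin ν v) 2 :=
    ⟨aestronglyMeasurable_expLin (meas v) _, lt_top_iff_ne_top.mpr fun h => hν (by simp [h])⟩
  set g : L2 n := memLp.toLp
  have laplace_v : laplaceTransform (normSqMeasure v) ((2 : ℝ) • ν) =
      laplaceTransform (normSqMeasure (𝓕 g : L2 n)) 0 := by
    have laplace_zero := laplaceTransform_normSqMeasure (meas (𝓕 g)) 0
    rw [smul_zero, expLin_zero, eLpNorm_fourier, eLpNorm_congr_ae memLp.coeFn_toLp] at laplace_zero
    rw [laplaceTransform_normSqMeasure (meas v), laplace_zero]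
  have laplace_chirp {j : ℝ} (hj : j ≠ 0) :
      laplaceTransform (normSqMeasure (𝓕 (chirpLp j v) : L2 n)) ((Real.pi / j) • (2 : ℝ) • ν) =
        laplaceTransform (normSqMeasure (𝓕 g : L2 n)) ((Real.pi / j) • (2 : ℝ) • ν) := by
    rw [smul_comm, laplaceTransform_normSqMeasure (meas _), laplaceTransform_normSqMeasure (meas _),
      eLpNorm_expLin_fourier_chirpLp hj ν memLp.coeFn_toLp]
  have rescale : (Real.pi / k) • (2 : ℝ) • ν = (k' / k) • (Real.pi / k') • (2 : ℝ) • ν := by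
    rw [smul_smul (k' / k)]
    congr 1
    field_simp
  rw [laplace_chirp hk.ne', laplace_chirp hk'.ne', laplace_v, rescale]
  exact laplaceTransform_smul_le _ _ ⟨by positivity, (div_le_one hk).mpr hkk'⟩

theorem laplaceTransform_fourier_chirpLp_le (v : L2 n) {k k' : ℝ} (hk' : 0 < k') (hkk' : k' ≤ k)
    (l : EuclideanSpace ℝ (Fin n)) :
    laplaceTransform (normSqMeasure (𝓕 (chirpLp k v) : L2 n)) ((Real.pi / k) • l) ≤
      laplaceTransform (normSqMeasure v) l ^ (1 - k' / k) *
        laplaceTransform (normSqMeasure (𝓕 (chirpLp k' v) : L2 n)) ((Real.pi / k') • l) ^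
          (k' / k) := by
  have hk : 0 < k := hk'.trans_le hkk'
  rcases hkk'.eq_or_lt with rfl | hlt
  · simp [hk.ne']
  by_cases htop : laplaceTransform (normSqMeasure v) l = ∞
  · rcases eq_or_ne v 0 with rfl | hv
    · rw [laplaceTransform_eq_zero_iff.mpr
        (normSqMeasure_eq_zero_iff.mpr (fourier_chirpLp_eq_zero_iff.mpr rfl))]
      exact zero_le
    · rw [htop, ENNReal.top_rpow_of_pos (by rwa [sub_pos, div_lt_one hk]), ENNReal.top_mul]
      · exact le_top
      · rwa [Ne, ENNReal.rpow_eq_zero_iff_of_pos (by positivity), laplaceTransform_eq_zero_iff,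
          normSqMeasure_eq_zero_iff, fourier_chirpLp_eq_zero_iff]
  obtain ⟨ν, rfl⟩ : ∃ ν : EuclideanSpace ℝ (Fin n), l = (2 : ℝ) • ν := ⟨(2⁻¹ : ℝ) • l, by simp⟩
  exact laplaceTransform_fourier_chirpLp_le_of_ne_top v hk' hkk' htop

end ChirpedFourier

section ExpPowNorm

variable {n : ℕ} {p : ℝ}

lemma expPowNorm_sq (hp : p ≠ 0) (r : ℝ) {f : EuclideanSpace ℝ (Fin n) → ℂ}
    (hf : AEStronglyMeasurable f volume) :
    expPowNorm p r f ^ 2 = ∫⁻ x, ENNReal.ofReal (Real.exp (‖x‖ ^ p))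
      ∂(normSqMeasure f).map (((2 : ℝ) ^ (1 / p) * r) • ·) := by
  rw [expPowNorm, eLpNorm_real_exp_mul_sq hf (by fun_prop),
    lintegral_map (by fun_prop) (by fun_prop)]
  refine lintegral_congr fun x => ?_
  rw [mul_smul, norm_smul _ (r • x), Real.norm_of_nonneg (by positivity),
    Real.mul_rpow (by positivity) (norm_nonneg _), ← Real.rpow_mul zero_le_two,
    one_div_mul_cancel hp, Real.rpow_one]

lemma expPowNorm_congr_norm (r : ℝ) {f g : EuclideanSpace ℝ (Fin n) → ℂ}
    (h : ∀ᵐ x, ‖f x‖ = ‖g x‖) : expPowNorm p r f = expPowNorm p r g :=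
  eLpNorm_congr_norm_ae (h.mono fun x hx => by rw [norm_mul, norm_mul, hx])

theorem expPowNorm_fourier_chirpLp_le (hp : 1 < p) (v : L2 n) {k k' : ℝ} (hk' : 0 < k')
    (hkk' : k' ≤ k) (r : ℝ) :
    expPowNorm p (Real.pi / k * r) (𝓕 (chirpLp k v) : L2 n) ≤
      ENNReal.ofReal (Real.sqrt (powConst n p)) * expPowNorm p r v ^ (1 - k' / k) *
        expPowNorm p (Real.pi / k' * r) (𝓕 (chirpLp k' v) : L2 n) ^ (k' / k) := by
  have hk : 0 < k := hk'.trans_le hkk'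
  have hp0 : p ≠ 0 := by positivity
  have meas (f : L2 n) := Lp.aestronglyMeasurable f
  have interpolate := lintegral_exp_norm_rpow_interpolate hp
    (μ := (normSqMeasure (𝓕 (chirpLp k v) : L2 n)).map
      (((2 : ℝ) ^ (1 / p) * (Real.pi / k * r)) • ·))
    (μ₀ := (normSqMeasure v).map (((2 : ℝ) ^ (1 / p) * r) • ·))
    (μ₁ := (normSqMeasure (𝓕 (chirpLp k' v) : L2 n)).map
      (((2 : ℝ) ^ (1 / p) * (Real.pi / k' * r)) • ·))
    ⟨div_nonneg hk'.le hk.le, (div_le_one hk).mpr hkk'⟩ fun l => by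
      simp only [laplaceTransform_map_smul, mul_left_comm _ (Real.pi / _) r]
      simpa only [mul_smul] using
        laplaceTransform_fourier_chirpLp_le v hk' hkk' (((2 : ℝ) ^ (1 / p) * r) • l)
  rw [← expPowNorm_sq hp0 _ (meas _), ← expPowNorm_sq hp0 _ (meas _),
    ← expPowNorm_sq hp0 _ (meas _), finrank_euclideanSpace_fin] at interpolate
  refine (ENNReal.pow_right_strictMono two_ne_zero).le_iff_le.mp (interpolate.trans_eq ?_)
  rw [mul_pow, mul_pow, ← ENNReal.ofReal_pow (Real.sqrt_nonneg _),
    Real.sq_sqrt (zero_le_one.trans (one_le_powConst n hp))]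
  simp only [← ENNReal.rpow_natCast, ← ENNReal.rpow_mul, mul_comm]

end ExpPowNorm

section Dilation

variable {n : ℕ} {r : ℝ} {f : EuclideanSpace ℝ (Fin n) → ℂ}

lemma map_smul_volume (hr : 0 < r) :
    Measure.map (r • ·) (volume : Measure (EuclideanSpace ℝ (Fin n))) =
      ENNReal.ofReal (r ^ n)⁻¹ • volume := by
  rw [Measure.map_addHaar_smul volume hr.ne', finrank_euclideanSpace_fin,
    abs_of_pos (by positivity)]

lemma measurableEmbedding_smul (hr : r ≠ 0) :
    MeasurableEmbedding (r • · : EuclideanSpace ℝ (Fin n) → EuclideanSpace ℝ (Fin n)) :=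
  (Homeomorph.smulOfNeZero r hr).measurableEmbedding

lemma memLp_comp_smul (hr : 0 < r) (hf : MemLp f 2) : MemLp (fun x => f (r • x)) 2 := by
  have := hf.smul_measure (c := ENNReal.ofReal (r ^ n)⁻¹) ENNReal.ofReal_ne_top
  rwa [← map_smul_volume hr, (measurableEmbedding_smul hr.ne').memLp_map_measure_iff] at this

lemma eLpNorm_const_mul_comp_smul (hr : 0 < r) {κ : ℂ} (hκ : ‖κ‖ ^ 2 = r ^ n)
    (f : EuclideanSpace ℝ (Fin n) → ℂ) :
    eLpNorm (fun x => κ * f (r • x)) 2 volume = eLpNorm f 2 volume := by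
  have hκ0 : 0 < ‖κ‖ ^ 2 := hκ ▸ pow_pos hr n
  have comp_smul : eLpNorm (fun x => f (r • x)) 2 volume = ‖κ‖ₑ⁻¹ * eLpNorm f 2 volume := by
    have := (measurableEmbedding_smul hr.ne').eLpNorm_map_measure (g := f) (p := 2) (μ := volume)
    rw [map_smul_volume hr, eLpNorm_smul_measure_of_ne_top ENNReal.ofNat_ne_top, ← hκ,
      ENNReal.ofReal_inv_of_pos hκ0, ENNReal.ofReal_pow (norm_nonneg κ), ofReal_norm,
      ENNReal.inv_pow, ← ENNReal.rpow_natCast, ← ENNReal.rpow_mul] at this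
    simpa [Function.comp_def] using this.symm
  change eLpNorm (κ • fun x => f (r • x)) 2 volume = _
  rw [eLpNorm_const_smul, comp_smul, ← mul_assoc, ENNReal.mul_inv_cancel _ enorm_ne_top, one_mul]
  rintro h
  simp [enorm_eq_zero.mp h] at hκ0

lemma expPowNorm_const_mul_comp_smul (hr : 0 < r) {κ : ℂ} (hκ : ‖κ‖ ^ 2 = r ^ n) (p ρ : ℝ)
    (f : EuclideanSpace ℝ (Fin n) → ℂ) :
    expPowNorm p ρ (fun x => κ * f (r • x)) = expPowNorm p (ρ / r) f := by
  have comp_smul := eLpNorm_const_mul_comp_smul hr hκ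
    fun x => (Real.exp (‖(ρ / r) • x‖ ^ p) : ℂ) * f x
  simp only [smul_smul, div_mul_cancel₀ ρ hr.ne', mul_left_comm κ] at comp_smul
  exact comp_smul

lemma gaussTransform_comp_smul (hr : 0 < r) (f : EuclideanSpace ℝ (Fin n) → ℂ) (c : ℂ)
    (b : Fin n → ℂ) :
    gaussTransform (fun x => f (r • x)) c b =
      (r ^ n : ℝ)⁻¹ * gaussTransform f (c / r ^ 2) (fun i => b i / r) := by
  have hr' : (r : ℂ) ≠ 0 := mod_cast hr.ne'
  have gaussFn_smul (x : EuclideanSpace ℝ (Fin n)) :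
      gaussFn (c / r ^ 2) (fun i => b i / r) (r • x) = gaussFn c b x := by
    simp only [gaussFn, norm_smul, PiLp.smul_apply, smul_eq_mul, Real.norm_eq_abs, abs_of_pos hr]
    push_cast
    field_simp
  have := Measure.integral_comp_smul volume
    (fun y => f y * gaussFn (c / r ^ 2) (fun i => b i / r) y) r
  simp_rw [gaussFn_smul] at this
  rw [gaussTransform, this, finrank_euclideanSpace_fin, abs_of_pos (by positivity),
    Complex.real_smul, Complex.ofReal_inv, gaussTransform]

end Dilation

section LensFormula

variable {n : ℕ} {v w : L2 n}

lemma gaussConst_eq_gaussConst_zero_mul_exp (c : ℂ) (b : Fin n → ℂ) :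
    gaussConst c b = gaussConst c (0 : Fin n → ℂ) * Complex.exp ((∑ i, b i ^ 2) / (4 * c)) := by
  simp [gaussConst]

lemma gaussConst_mul_gaussTransform_eq {k : ℝ}
    (h : (𝓕⁻ w : L2 n) =ᵐ[volume] chirp (-k) (𝓕⁻ v : L2 n)) {c d : ℂ} (hc : 0 < c.re)
    (hd : 0 < d.re) (hcd : Real.pi ^ 2 / d = Real.pi ^ 2 / c + Complex.I * k) (b : Fin n → ℂ) :
    gaussConst d (fun i => d * b i / c) * gaussTransform w c b =
      gaussConst c b * gaussTransform v d (fun i => d * b i / c) := by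
  have hd0 : d ≠ 0 := fun h => by simp [h] at hd
  have transform_w := gaussTransform_fourier (𝓕⁻ w) hc b
  have transform_v := gaussTransform_fourier (𝓕⁻ v) hd (fun i => d * b i / c)
  have argument_eq : (fun i => -Complex.I * Real.pi * (d * b i / c) / d) =
      fun i => -Complex.I * Real.pi * b i / c := by
    ext i
    field_simp
  rw [FourierTransform.fourier_fourierInv_eq, gaussTransform_congr h, gaussTransform_chirp]
    at transform_w
  rw [FourierTransform.fourier_fourierInv_eq, hcd, argument_eq] at transform_v
  rw [transform_w, transform_v, mul_left_comm, Complex.ofReal_neg, mul_neg, sub_neg_eq_add]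

lemma gaussTransform_chirp_fourier_comp_smul (v : L2 n) {m r : ℝ} (hr : 0 < r) {c d : ℂ}
    (hc : 0 < c.re) (hcd : d = (Real.pi * r) ^ 2 / (c - Complex.I * m) - Complex.I * m)
    (b : Fin n → ℂ) :
    gaussTransform (chirp m fun x => (𝓕 (chirpLp m v) : L2 n) (r • x)) c b =
      (r ^ n : ℝ)⁻¹ * (gaussConst ((c - Complex.I * m) / r ^ 2) (fun i => b i / r) *
        gaussTransform v d (fun i => -Complex.I * (Real.pi * r) * b i / (c - Complex.I * m))) := by
  have re_pos : 0 < ((c - Complex.I * m) / r ^ 2).re := by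
    rw [← Complex.ofReal_pow, Complex.div_ofReal_re]
    simpa using div_pos hc (pow_pos hr 2)
  rw [gaussTransform_chirp, gaussTransform_comp_smul hr, gaussTransform_fourier _ re_pos,
    gaussTransform_chirpLp]
  congr 3
  · rw [hcd]
    field_simp
  · ext i
    field_simp

/-- The constant by which the free evolution at time `1 / 4m` differs from a chirp, a dilation by
`m / π` and the Fourier transform of a chirp. The points `m`, `m / (1 + i)` and `(1 - i) π² / m`
are the Gaussian parameters at which the two sides are compared. -/
noncomputable def lensConst (n : ℕ) (m : ℝ) : ℂ :=
  gaussConst m (0 : Fin n → ℂ) / (gaussConst (m / (1 + Complex.I)) (0 : Fin n → ℂ) *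
    (((m / Real.pi) ^ n : ℝ)⁻¹ *
      gaussConst (Real.pi ^ 2 / m * (1 - Complex.I)) (0 : Fin n → ℂ)))

lemma one_add_I_ne_zero : (1 + Complex.I : ℂ) ≠ 0 := fun h => by simpa using congrArg Complex.re h

lemma one_sub_I_ne_zero : (1 - Complex.I : ℂ) ≠ 0 := fun h => by simpa using congrArg Complex.re h

lemma norm_lensConst_sq {m : ℝ} (hm : 0 < m) : ‖lensConst n m‖ ^ 2 = (m / Real.pi) ^ n := by
  have hm' : (m : ℂ) ≠ 0 := mod_cast hm.ne'
  have norm_mul_norm : ‖(m : ℂ) / (1 + Complex.I)‖ * ‖Real.pi ^ 2 / m * (1 - Complex.I)‖ =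
      Real.pi ^ 2 := by
    have product_eq : (m : ℂ) / (1 + Complex.I) * (Real.pi ^ 2 / m * (1 - Complex.I)) =
        -Complex.I * Real.pi ^ 2 := by
      have := one_add_I_ne_zero
      field_simp
      linear_combination Complex.I_sq
    rw [← norm_mul, product_eq]
    simp [abs_of_pos Real.pi_pos]
  have cancel : (Real.pi / ‖(m : ℂ) / (1 + Complex.I)‖) ^ (n / 2 : ℝ) *
      (Real.pi / ‖Real.pi ^ 2 / m * (1 - Complex.I)‖) ^ (n / 2 : ℝ) = 1 := by
    rw [← Real.mul_rpow (by positivity) (by positivity), div_mul_div_comm, norm_mul_norm, ← sq,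
      div_self (by positivity), Real.one_rpow]
  have half_pow : ((Real.pi / m) ^ (n / 2 : ℝ)) ^ 2 = (Real.pi / m) ^ n := by
    rw [← Real.rpow_mul_natCast (by positivity)]
    simp
  rw [lensConst, norm_div, norm_mul, norm_mul, mul_left_comm, norm_gaussConst_zero,
    norm_gaussConst_zero, norm_gaussConst_zero, cancel, mul_one, div_pow, Complex.norm_real,
    Real.norm_of_nonneg hm.le, half_pow, Complex.norm_real,
    Real.norm_of_nonneg (by positivity : 0 ≤ ((m / Real.pi) ^ n)⁻¹), ← inv_div m, inv_pow, inv_pow]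
  field_simp

lemma lensConst_mul_gaussConst {m : ℝ} (hm : 0 < m) (b : Fin n → ℂ) :
    lensConst n m * gaussConst (m / (1 + Complex.I)) (fun i => m / (1 + Complex.I) * b i / m) *
        (((m / Real.pi) ^ n : ℝ)⁻¹ * gaussConst ((m - Complex.I * m) / (m / Real.pi : ℝ) ^ 2)
          (fun i => b i / (m / Real.pi : ℝ))) =
      gaussConst m b := by
  have hm' : (m : ℂ) ≠ 0 := mod_cast hm.ne'
  have hpi : (Real.pi : ℂ) ≠ 0 := mod_cast Real.pi_ne_zero
  have h_add := one_add_I_ne_zero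
  have h_sub := one_sub_I_ne_zero
  have parameter_eq : (m - Complex.I * m) / ((m / Real.pi : ℝ) : ℂ) ^ 2 =
      Real.pi ^ 2 / m * (1 - Complex.I) := by
    push_cast
    field_simp
  have exp_mul_exp : Complex.exp ((∑ i, (m / (1 + Complex.I) * b i / m) ^ 2) /
        (4 * (m / (1 + Complex.I)))) * Complex.exp ((∑ i, (b i / (m / Real.pi : ℝ)) ^ 2) /
        (4 * (Real.pi ^ 2 / m * (1 - Complex.I)))) =
      Complex.exp ((∑ i, b i ^ 2) / (4 * m)) := by
    rw [← Complex.exp_add]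
    congr 1
    simp only [Finset.sum_div, ← Finset.sum_add_distrib]
    refine Finset.sum_congr rfl fun i _ => ?_
    push_cast
    field_simp
    linear_combination b i ^ 2 * Complex.I_sq
  rw [parameter_eq, gaussConst_eq_gaussConst_zero_mul_exp m b, ← exp_mul_exp, lensConst,
    gaussConst_eq_gaussConst_zero_mul_exp _ fun i => _ * b i / _,
    gaussConst_eq_gaussConst_zero_mul_exp _ fun i => b i / _]
  have ne_zero : gaussConst (m / (1 + Complex.I)) (0 : Fin n → ℂ) ≠ 0 :=
    gaussConst_ne_zero (by simp [*]) _
  have ne_zero' : gaussConst (Real.pi ^ 2 / m * (1 - Complex.I)) (0 : Fin n → ℂ) ≠ 0 :=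
    gaussConst_ne_zero (by simp [*]) _
  generalize gaussConst (Real.pi ^ 2 / m * (1 - Complex.I)) (0 : Fin n → ℂ) = C at ne_zero' ⊢
  field_simp

lemma gaussTransform_eq_lensConst_mul {m : ℝ} (hm : 0 < m)
    (h : (𝓕⁻ w : L2 n) =ᵐ[volume] chirp (-(Real.pi ^ 2 / m)) (𝓕⁻ v : L2 n)) (b : Fin n → ℂ) :
    gaussTransform w m b = lensConst n m * gaussTransform (chirp m fun x =>
      (𝓕 (chirpLp m v) : L2 n) ((m / Real.pi) • x)) m b := by
  have hm' : (m : ℂ) ≠ 0 := mod_cast hm.ne'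
  have h_add := one_add_I_ne_zero
  have h_sub := one_sub_I_ne_zero
  have hd : 0 < ((m : ℂ) / (1 + Complex.I)).re := by
    rw [div_eq_mul_inv, Complex.re_ofReal_mul, Complex.inv_re]
    exact mul_pos hm (by norm_num [Complex.normSq_apply])
  have transform_w := gaussConst_mul_gaussTransform_eq h (c := m) (by simpa) hd (by
    push_cast
    field_simp) b
  have transform_fourier := gaussTransform_chirp_fourier_comp_smul v (m := m)
    (by positivity : 0 < m / Real.pi) (c := m) (by simpa) (d := m / (1 + Complex.I)) (by
      push_cast
      field_simp
      linear_combination -Complex.I * Complex.I_sq) b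
  have argument_eq : (fun i => -Complex.I * (Real.pi * (m / Real.pi : ℝ)) * b i /
      (m - Complex.I * m)) = fun i => m / (1 + Complex.I) * b i / m := by
    ext i
    push_cast
    field_simp
    linear_combination -b i * Complex.I_sq
  rw [argument_eq] at transform_fourier
  refine mul_left_cancel₀ (gaussConst_ne_zero (by simp [*]) _) (transform_w.trans ?_)
  rw [transform_fourier, ← lensConst_mul_gaussConst hm b]
  ring

theorem ae_eq_lensConst_mul_chirp_fourier {m : ℝ} (hm : 0 < m)
    (h : (𝓕⁻ w : L2 n) =ᵐ[volume] chirp (-(Real.pi ^ 2 / m)) (𝓕⁻ v : L2 n)) :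
    w =ᵐ[volume] fun x => lensConst n m *
      chirp m (fun x => (𝓕 (chirpLp m v) : L2 n) ((m / Real.pi) • x)) x :=
  ae_eq_of_gaussTransform_eq (gaussIntegrable_of_memLp (Lp.memLp _))
    (gaussIntegrable_of_memLp (memLp_chirp (memLp_comp_smul (by positivity) (Lp.memLp _)) m))
    (c := m) (by simpa) _ (gaussTransform_eq_lensConst_mul hm h)

end LensFormula

section WeightedEstimates

variable {n : ℕ} {p α β t T : ℝ} {u₀ : L2 n} {u : ℝ → L2 n}

lemma expPowNorm_angularFourier (p ρ : ℝ) (f : L2 n) :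
    expPowNorm p ρ (angularFourier f) = expPowNorm p (2 * Real.pi * ρ) (𝓕 f : L2 n) := by
  have norm_const : ‖(((2 * Real.pi) ^ (-(n : ℝ) / 2) : ℝ) : ℂ)‖ ^ 2 = (2 * Real.pi)⁻¹ ^ n := by
    rw [Complex.norm_real, Real.norm_of_nonneg (by positivity),
      ← Real.rpow_mul_natCast (by positivity), Nat.cast_ofNat, div_mul_cancel₀ _ two_ne_zero,
      Real.rpow_neg (by positivity), Real.rpow_natCast, inv_pow]
  refine (expPowNorm_const_mul_comp_smul (by positivity) norm_const p ρ _).trans ?_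
  rw [div_inv_eq_mul, mul_comm]

lemma IsFreeSchrodingerSolution.expPowNorm_eq (hu : IsFreeSchrodingerSolution u₀ u) (ht : 0 < t)
    (p ρ : ℝ) :
    expPowNorm p ρ (u t) =
      expPowNorm p (4 * Real.pi * t * ρ) (𝓕 (chirpLp (1 / (4 * t)) u₀) : L2 n) := by
  have hm : 0 < 1 / (4 * t) := by positivity
  have evolution : (𝓕⁻ (u t) : L2 n) =ᵐ[volume]
      chirp (-(Real.pi ^ 2 / (1 / (4 * t)))) (𝓕⁻ u₀ : L2 n) := by
    convert hu.fourierInv_ae_eq ht.le using 2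
    field_simp
    ring
  set m := 1 / (4 * t) with hm_def
  have norm_eq : ∀ᵐ x, ‖u t x‖ =
      ‖lensConst n m * (𝓕 (chirpLp m u₀) : L2 n) ((m / Real.pi) • x)‖ :=
    (ae_eq_lensConst_mul_chirp_fourier hm evolution).mono fun x hx => by
      rw [hx, norm_mul, norm_chirp, norm_mul]
  rw [expPowNorm_congr_norm ρ norm_eq,
    expPowNorm_const_mul_comp_smul (by positivity) (norm_lensConst_sq hm), hm_def]
  congr 1
  field_simp

/-- Writing `f` as the chirp of another function shifts every chirp parameter by `a`; the choice of
`a` is where the linear growth `α t + β` of the weights comes from. -/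
lemma expPowNorm_fourier_chirpLp_add_le (hp : 1 < p) (f : L2 n) {a k k' : ℝ} (hk' : 0 < k' + a)
    (hkk' : k' ≤ k) (r : ℝ) :
    expPowNorm p (Real.pi / (k + a) * r) (𝓕 (chirpLp k f) : L2 n) ≤
      ENNReal.ofReal (Real.sqrt (powConst n p)) * expPowNorm p r f ^ (1 - (k' + a) / (k + a)) *
        expPowNorm p (Real.pi / (k' + a) * r) (𝓕 (chirpLp k' f) : L2 n) ^
          ((k' + a) / (k + a)) := by
  have := expPowNorm_fourier_chirpLp_le hp (chirpLp (-a) f) hk' (add_le_add_left hkk' a) r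
  have norm_chirp_eq : ∀ᵐ x, ‖chirpLp (-a) f x‖ = ‖f x‖ :=
    (coeFn_chirpLp (-a) f).mono fun x hx => by rw [hx, norm_chirp]
  rwa [chirpLp_chirpLp, chirpLp_chirpLp, add_neg_cancel_right, add_neg_cancel_right,
    expPowNorm_congr_norm r norm_chirp_eq] at this

lemma one_div_add_div_four_mul (ht : t ≠ 0) (hβ : β ≠ 0) :
    1 / (4 * t) + α / (4 * β) = (α * t + β) / (4 * t * β) := by
  field_simp
  ring

theorem IsFreeSchrodingerSolution.expPowNorm_le_theta (hu : IsFreeSchrodingerSolution u₀ u)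
    (hp : 1 < p) (hβ : 0 < β) (hT : 0 < α * T + β) (ht : 0 < t) (htT : t ≤ T) :
    expPowNorm p (1 / (α * t + β)) (u t) ≤
      ENNReal.ofReal (Real.sqrt (powConst n p)) * expPowNorm p (1 / β) u₀ ^ thetaExp α β T t *
        expPowNorm p (1 / (α * T + β)) (u T) ^ (1 - thetaExp α β T t) := by
  have hT0 : 0 < T := ht.trans_le htT
  have hαt : 0 < α * t + β := by
    nlinarith [mul_pos ht hT, mul_nonneg (sub_nonneg.mpr htT) hβ.le]
  have estimate := expPowNorm_fourier_chirpLp_add_le hp u₀ (a := α / (4 * β)) (k := 1 / (4 * t))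
    (k' := 1 / (4 * T)) (by rw [one_div_add_div_four_mul hT0.ne' hβ.ne']; positivity)
    (one_div_le_one_div_of_le (by positivity) (by gcongr)) (1 / β)
  rw [one_div_add_div_four_mul ht.ne' hβ.ne', one_div_add_div_four_mul hT0.ne' hβ.ne'] at estimate
  have exponent_eq : (α * T + β) / (4 * T * β) / ((α * t + β) / (4 * t * β)) =
      1 - thetaExp α β T t := by
    rw [thetaExp]
    field_simp
    ring
  have radius_eq {s : ℝ} (hs : 0 < s) :
      Real.pi / ((α * s + β) / (4 * s * β)) * (1 / β) = 4 * Real.pi * s * (1 / (α * s + β)) := by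
    field_simp
  rwa [radius_eq ht, radius_eq hT0, exponent_eq, sub_sub_cancel, ← hu.expPowNorm_eq ht,
    ← hu.expPowNorm_eq hT0] at estimate

theorem IsFreeSchrodingerSolution.expPowNorm_le_mu (hu : IsFreeSchrodingerSolution u₀ u)
    (hp : 1 < p) (hα : 0 < α) (hβ : 0 < β) (ht : 0 < t) :
    expPowNorm p (1 / (α * t + β)) (u t) ≤
      ENNReal.ofReal (Real.sqrt (powConst n p)) * expPowNorm p (1 / β) u₀ ^ muExp α β t *
        expPowNorm p (2 / α) (angularFourier u₀) ^ (1 - muExp α β t) := by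
  have estimate := expPowNorm_fourier_chirpLp_add_le hp u₀ (a := α / (4 * β)) (k := 1 / (4 * t))
    (k' := 0) (by positivity) (by positivity) (1 / β)
  rw [chirpLp_zero, one_div_add_div_four_mul ht.ne' hβ.ne', zero_add] at estimate
  have exponent_eq : α / (4 * β) / ((α * t + β) / (4 * t * β)) = 1 - muExp α β t := by
    rw [muExp]
    field_simp
    ring
  have radius_eq : Real.pi / ((α * t + β) / (4 * t * β)) * (1 / β) =
      4 * Real.pi * t * (1 / (α * t + β)) := by
    field_simp
  have radius_zero_eq : Real.pi / (α / (4 * β)) * (1 / β) = 2 * Real.pi * (2 / α) := by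
    field_simp
    ring
  rwa [radius_eq, radius_zero_eq, exponent_eq, sub_sub_cancel, ← hu.expPowNorm_eq ht,
    ← expPowNorm_angularFourier] at estimate

end WeightedEstimates

theorem corollary3p3_general (n : ℕ) {p : ℝ} (hp : 1 < p) :
    ∃ c : ℝ, 0 < c ∧
      ∀ (α β : ℝ), 0 < β →
      ∀ (u₀ : L2 n) (u : ℝ → L2 n), IsFreeSchrodingerSolution u₀ u →
        (∀ T : ℝ, 0 < T → 0 < α * T + β → ∀ t ∈ Set.Icc (0 : ℝ) T,
          expPowNorm p (1 / (α * t + β)) (u t) ≤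
            ENNReal.ofReal c
              * expPowNorm p (1 / β) u₀ ^ thetaExp α β T t
              * expPowNorm p (1 / (α * T + β)) (u T) ^ (1 - thetaExp α β T t)) ∧
        (0 < α → ∀ t : ℝ, 0 ≤ t →
          expPowNorm p (1 / (α * t + β)) (u t) ≤
            ENNReal.ofReal c
              * expPowNorm p (1 / β) u₀ ^ muExp α β t
              * expPowNorm p (2 / α) (angularFourier u₀) ^ (1 - muExp α β t)) := by
  have one_le_sqrt : 1 ≤ Real.sqrt (powConst n p) := Real.one_le_sqrt.mpr (one_le_powConst n hp)
  have le_mul (x : ℝ≥0∞) : x ≤ ENNReal.ofReal (Real.sqrt (powConst n p)) * x :=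
    le_mul_of_one_le_left zero_le (ENNReal.one_le_ofReal.mpr one_le_sqrt)
  refine ⟨Real.sqrt (powConst n p), by positivity, fun α β hβ u₀ u hu =>
    ⟨fun T hT hαT t ht => ?_, fun hα t ht => ?_⟩⟩
  · rcases ht.1.eq_or_lt with rfl | ht0
    · have theta_eq : thetaExp α β T 0 = 1 := by
        rw [thetaExp, mul_zero, sub_zero, zero_add, mul_comm, div_self (by positivity)]
      simpa [theta_eq, hu.initial] using le_mul _
    · exact hu.expPowNorm_le_theta hp hβ hαT ht0 ht.2
  · rcases ht.eq_or_lt with rfl | ht0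
    · simpa [muExp, hu.initial, hβ.ne'] using le_mul _
    · exact hu.expPowNorm_le_mu hp hα hβ ht0

theorem corollary3p3 (n : ℕ) (hn : 1 ≤ n) (p : ℝ) (hp : p ∈ Set.Ioc (1 : ℝ) 2) :
    ∃ c : ℝ, 0 < c ∧
      ∀ (α β : ℝ), 0 < α → 0 < β →
      ∀ (u₀ : L2 n) (u : ℝ → L2 n), IsFreeSchrodingerSolution u₀ u →
        (∀ T : ℝ, 0 < T → ∀ t ∈ Set.Icc (0 : ℝ) T,
          expPowNorm p (1 / (α * t + β)) (u t) ≤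
            ENNReal.ofReal c
              * expPowNorm p (1 / β) u₀ ^ thetaExp α β T t
              * expPowNorm p (1 / (α * T + β)) (u T) ^ (1 - thetaExp α β T t)) ∧
        (∀ t : ℝ, 0 ≤ t →
          expPowNorm p (1 / (α * t + β)) (u t) ≤
            ENNReal.ofReal c
              * expPowNorm p (1 / β) u₀ ^ muExp α β t
              * expPowNorm p (2 / α) (angularFourier u₀) ^ (1 - muExp α β t)) := by
  obtain ⟨c, hc, h⟩ := corollary3p3_general n hp.1
  exact ⟨c, hc, fun α β hα hβ u₀ u hu => ⟨fun T hT => (h α β hβ u₀ u hu).1 T hT (by positivity),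
    (h α β hβ u₀ u hu).2 hα⟩⟩
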